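/- **Setting.** Let $\mathcal A$ be a set of $N$ agents that communicate over a connected undirected graph $\mathcal G$ of diameter $d(\mathcal G)$. Agent $i$ has a finite nonempty policy set $\mathcal P_i$; these sets are pairwise disjoint with union $\mathcal P$. Let $f:2^{\mathcal P}\to\mathbb R$ be normalized ($f(\emptyset)=0$), monotone increasing and submodular, and let $\mathcal S^\star$ maximize $f$ over the admissible sets $\mathcal I=\{\mathcal R\subseteq\mathcal P: |\mathcal R\cap\mathcal P_i|\le 1 \text{ for all } i\}$. Let $T\ge 1$ and $K_i\in\mathbb N$ ($i\in\mathcal A$). **Algorithm.** An information set is a finite set $\mathcal F$ of pairs $(p,\alpha)$ (policy, membership probability) with at most one pair per policy; its membership vector $\mathbf x$ has $x_p=\alpha$ if $(p,\alpha)\in\mathcal F$ and $x_p=0$ if $p$ has no pair. Initially $\mathcal F_i=\emptyset$ for all $i$. In each of $T$ time steps, every agent $i$ 1. draws $K_i$ independent random sets $\mathcal R$, each containing every $q\in\mathcal P$ independently with probability $x_{iq}$, where $\mathbf x_i$ is the membership vector of $\mathcal F_i$ (draws of different agents and time steps use independent randomness); 2. computes for each $p\in\mathcal P_i$ the average $w^i_p$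 of $f(\mathcal R\cup\{p\})-f(\mathcal R\setminus\{p\})$ over the sampled sets; 3. picks $p^\star\in\arg\max_{p\in\mathcal P_i}w_p^i$ (ties broken by any fixed rule, possibly depending on the agent and the time step) and forms $\mathcal F_i^-$ from $\mathcal F_i$ by adding $1/T$ to the value of $p^\star$ (inserting $(p^\star,1/T)$ if $p^\star$ has no value); 4. replaces $\mathcal F_i$ by the set of those pairs of $\bigcup_j\mathcal F_j^-$, with $j$ ranging over $i$ and its neighbors, that have the largest value for their policy. After $T$ steps, the agents independently sample one policy each, agent $i$ choosing $p\in\mathcal P_i$ with probability $x_{ip}(T)$; $\bar{\mathcal P}$ is the set of the sampled policies. *Batches.* More generally, let a map $\beta$ from $\mathcal P$ to a finite set of labels be given. For each label, agent $i$ draws a separate independent batch of $K_i$ sets in step 1, and in step 2 it computes $w_p^i$ from the batch with label $\beta(p)$. Constant $\beta$ is the algorithm above, in which all policies of an agent use the same $K_i$ sets; injective $\beta$ means that the estimates of different policies use independently drawn sets. **Theorem.** Suppose that $2\,m\,e^{-K_i/(8T^2)}\le 1$ for every agent $i$ and every number $m=|\{p\in\mathcal P_i:\beta(p)=l\}|$,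 $l$ a label (for the algorithm with one common batch per agent: $2\,|\mathcal P_i|\,e^{-K_i/(8T^2)}\le 1$; for separate batches: $2e^{-K_i/(8T^2)}\le 1$). Then: * all membership probabilities $x_{ip}(t)$, $0\le t\le T$, lie in $[0,1]$, $\sum_{p\in\mathcal P_i}x_{ip}(T)=1$ for every $i$, and $\bar{\mathcal P}\in\mathcal I$ always; * with probability at least $\Big(\prod_{i\in\mathcal A}\big(1-2e^{-K_i/(8T^2)}\big)^{|\mathcal P_i|}\Big)^T$ over the sets sampled in the $T$ time steps, $$\Big(1-\frac1e\Big)\Big(1-\Big(2N^2d(\mathcal G)+\tfrac12N^2+N\Big)\frac1T\Big)f(\mathcal S^\star)\ \le\ \mathbb E[f(\bar{\mathcal P})],$$ where $\mathbb E$ is the expectation over the final sampling of the policies, given the final information sets. -/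

import Mathlib

open scoped BigOperators

noncomputable section

namespace DistGreedy

/-! ### Set functions and the optimization problem -/

/-- Diminishing returns: `f (S₁ ∪ {p}) - f S₁ ≥ f (S₂ ∪ {p}) - f S₂` whenever `S₁ ⊆ S₂`
and `p ∉ S₂`. -/
def IsSubmodular {P : Type*} [DecidableEq P] (f : Finset P → ℝ) : Prop :=
  ∀ S₁ S₂ : Finset P, S₁ ⊆ S₂ → ∀ p, p ∉ S₂ →
    f (insert p S₂) - f S₂ ≤ f (insert p S₁) - f S₁

/-- Independent sets of the partition matroid: at most one policy per agent. -/
def Admissible {A P : Type*} [DecidableEq P] (Pol : A → Finset P) (R : Finset P) : Prop :=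
  ∀ i, (R ∩ Pol i).card ≤ 1

/-- `S` maximizes `f` over the partition matroid. -/
def IsOptimizer {A P : Type*} [DecidableEq P] (Pol : A → Finset P) (f : Finset P → ℝ)
    (S : Finset P) : Prop :=
  Admissible Pol S ∧ ∀ R, Admissible Pol R → f R ≤ f S

/-! ### Finite random objects -/

/-- The law of a finite family of independent random variables with laws `μ i`. -/
def indep {ι : Type*} [Fintype ι] [DecidableEq ι] {X : ι → Type*} [∀ i, Fintype (X i)]
    (μ : ∀ i, PMF (X i)) : PMF (∀ i, X i) :=
  PMF.ofFintype (fun x => ∏ i, μ i (x i)) (by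
    rw [← Fintype.prod_sum (fun i a => μ i a)]
    refine Finset.prod_eq_one fun i _ => ?_
    rw [← tsum_fintype (L := SummationFilter.unconditional _)]
    exact (μ i).tsum_coe)

/-- Truncation of a real number to `[0, 1]`. -/
def clip (a : ℝ) : ℝ := max 0 (min 1 a)

theorem clip_nonneg (a : ℝ) : 0 ≤ clip a := le_max_left _ _

theorem clip_le_one (a : ℝ) : clip a ≤ 1 := max_le zero_le_one (min_le_left _ _)

/-- The law of the random set `R_x` that contains each `p` independently with probability `x p`.
(The truncation only serves to have a law for every `x`; it does nothing if `0 ≤ x p ≤ 1`.) -/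
def randomSet {P : Type*} [Fintype P] [DecidableEq P] (x : P → ℝ) : PMF (Finset P) :=
  PMF.ofFintype
    (fun R => ENNReal.ofReal ((∏ p ∈ R, clip (x p)) * ∏ p ∈ Rᶜ, (1 - clip (x p)))) (by
    rw [← ENNReal.ofReal_sum_of_nonneg, ← Fintype.prod_add]
    · simp
    · intro R _
      exact mul_nonneg (Finset.prod_nonneg fun p _ => clip_nonneg _)
        (Finset.prod_nonneg fun p _ => sub_nonneg.2 (clip_le_one _)))

/-! ### Information sets -/

/-- An information set: finitely many pairs (policy, membership probability). -/
abbrev Info (P : Type*) := Finset (P × ℝ)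

/-- `F ⊕ {(p, a)}`: add `a` to the value attached to `p`, or insert `(p, a)` if `p` has no
value yet. -/
def Info.add {P : Type*} [DecidableEq P] (F : Info P) (p : P) (a : ℝ) : Info P :=
  open Classical in
  F.filter (fun u => u.1 ≠ p)
    ∪ (F.filter (fun u => u.1 = p)).image (fun u => (u.1, u.2 + a))
    ∪ (if ∃ c, (p, c) ∈ F then ∅ else {(p, a)})

/-- The operation `MAX` over a family of information sets: from the union of the family, keep the
pairs whose value is the largest one attached to their policy. -/
def Info.max {P ι : Type*} (s : Finset ι) (F : ι → Info P) : Info P :=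
  open Classical in
  (s.biUnion F).filter (fun u => ∀ c, (u.1, c) ∈ s.biUnion F → c ≤ u.2)

/-- The membership probability vector read off an information set: `x p = a` if `(p, a) ∈ F`, and
`0` if `p` has no value. (The information sets of the algorithm hold at most one pair for
each `p`, so the sum has at most one term.) -/
def Info.prob {P : Type*} [DecidableEq P] (F : Info P) (p : P) : ℝ :=
  ∑ u ∈ F.filter (fun u => u.1 = p), u.2

/-! ### The distributed algorithm -/

section Algorithm

variable {A P L : Type*} [Fintype A] [DecidableEq A] [Fintype P] [DecidableEq P]
  [Fintype L] [DecidableEq L]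

/-- The sample sets drawn by all agents in one time step: `ω i l k` is the `k`-th of the `K i` sets
in the batch with label `l` of agent `i`. With a one-element label type every agent draws exactly
one batch of `K i` sets. -/
abbrev Samples (P L : Type*) {A : Type*} (K : A → ℕ) := ∀ i : A, L → Fin (K i) → Finset P

/-- All sample sets of one time step are drawn independently, those of agent `i` according to its
current membership probabilities. -/
def drawSamples (K : A → ℕ) (F : A → Info P) : PMF (Samples P L K) :=
  indep fun i => indep fun _ : L => indep fun _ : Fin (K i) => randomSet (F i).prob

/-- The estimate of `E[f(R ∪ {p}) - f(R \ {p})]`: the average over a batch of `k` sets. -/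
def estimate (f : Finset P → ℝ) {k : ℕ} (R : Fin k → Finset P) (p : P) : ℝ :=
  (∑ j, (f (insert p (R j)) - f ((R j).erase p))) / k

/-- A rule that selects, at every time step and for every agent, a policy of that agent from
the estimates of all its policies. -/
abbrev Selection (Pol : A → Finset P) :=
  ℕ → ∀ i : A, ({p // p ∈ Pol i} → ℝ) → {p // p ∈ Pol i}

/-- The selected policy always maximizes the estimate; ties are broken in any way. -/
def Selection.IsArgmax {Pol : A → Finset P} (sel : Selection Pol) : Prop :=
  ∀ (t : ℕ) (i : A) (w : {p // p ∈ Pol i} → ℝ) (p : {p // p ∈ Pol i}), w p ≤ w (sel t i w)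

variable (G : SimpleGraph A) (Pol : A → Finset P) (f : Finset P → ℝ) (T : ℕ) (K : A → ℕ)
  (β : P → L) (sel : Selection Pol)

/-- The propagated information sets: agent `i` estimates the gain of each of its policies `p` on its
batch with label `β p` and adds `1 / T` to the probability of the selected policy. -/
def propagate (t : ℕ) (F : A → Info P) (ω : Samples P L K) (i : A) : Info P :=
  (F i).add (sel t i fun p => estimate f (ω i (β p)) p) (1 / T)

/-- An agent together with its neighbors in the communication graph. -/
def closedNbhd (i : A) : Finset A :=
  open Classical in Finset.univ.filter fun j => j = i ∨ G.Adj i j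

/-- One time step: propagation, then `MAX` over the agent and its neighbors. -/
def step (t : ℕ) (F : A → Info P) (ω : Samples P L K) (i : A) : Info P :=
  Info.max (closedNbhd G i) (propagate Pol f T K β sel t F ω)

/-- The law of the information sets of all agents after `t` time steps. -/
def run : ℕ → PMF (A → Info P)
  | 0 => PMF.pure fun _ => ∅
  | t + 1 => (run t).bind fun F =>
      (drawSamples (L := L) K F).map (step G Pol f T K β sel t F)

/-- Agent `i` samples one policy of `Pol i` with its own membership probabilities. (If these do not
sum to one, nothing is sampled.) -/
def samplePolicy (F : A → Info P) (i : A) : PMF (Finset P) :=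
  open Classical in
  if h : ∑ p : {p // p ∈ Pol i}, ENNReal.ofReal ((F i).prob p) = 1 then
    (PMF.ofFintype (fun p : {p // p ∈ Pol i} => ENNReal.ofReal ((F i).prob p)) h).map
      fun p => {(p : P)}
  else PMF.pure ∅

/-- The law of the output policy set, given the final information sets: the agents sample
independently and their choices are collected. -/
def output (F : A → Info P) : PMF (Finset P) :=
  (indep (samplePolicy Pol F)).map fun s => Finset.univ.biUnion s

/-- The expected utility of the output policy set, given the final information sets. -/
def expectedUtility (F : A → Info P) : ℝ :=
  ∑ S : Finset P, (output Pol F S).toReal * f S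

end Algorithm

end DistGreedy

end

open scoped BigOperators

/-! The argument is continuous greedy on the multilinear extension F(x) = E f(R_x), evaluated at the
vector x = `ownProb` that collects, from every agent, the probabilities of its own policies. No
single agent need know x, yet each time step adds exactly 1/T to one coordinate of x per agent. Let
M = f(S*). Singletons are admissible, so M bounds every marginal gain.

If every agent raised a policy of largest slope of F at x, the first-order gain would be at least (M
- F(x))/T (`le_multilinear_add_sum_marginal`). Three errors intervene, in units of M/T². Slopes drop
while N coordinates rise together: N²/2 (`le_multilinear_add_indicator`). News travels one edge per
step, so an agent's vector lies below x by at most N d/T in the sum norm (`Invariant.sum_lag_le`);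
slopes are antitone and M-Lipschitz, so this costs N d per agent. Estimation costs M/(2T) twice per
agent: N in all. Hence F(x(t+1)) ≥ (1 - 1/T) F(x(t)) + C M/T with C the bracket of the theorem
(`Invariant.progress`), which unrolls to the factor 1 - (1 - 1/T)^T ≥ 1 - 1/e.

Estimates from one batch are dependent, so Hoeffding is combined with a union bound, and
`one_sub_pow_le` turns the result into the product form that multiplies over labels, agents and, by
conditioning, time steps (`le_run_toOuterMeasure`). Finally F is concave along nonnegative
directions, so sampling one policy per agent yields at least F(x) in expectation
(`multilinear_le_mean_indep`). -/

namespace DistGreedy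

/-! ### The multilinear extension and its first- and second-order bounds. -/

section Multilinear

variable {P : Type*} [DecidableEq P]

theorem insert_erase_eq_insert (p : P) (R : Finset P) : insert p (R.erase p) = insert p R := by
  ext q; by_cases hq : q = p <;> simp [hq]

/-- The marginal gain of `p`: the value with `p` minus the value without `p`. -/
def marginal (g : Finset P → ℝ) (p : P) (R : Finset P) : ℝ :=
  g (insert p R) - g (R.erase p)

/-- Erasing `p` first makes diminishing returns applicable even when the sets contain `p`. -/
theorem marginal_antitone {f : Finset P → ℝ} (hsub : IsSubmodular f) (p : P) :
    Antitone (marginal f p) := by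
  intro R S hRS
  have := hsub (R.erase p) (S.erase p) (Finset.erase_subset_erase p hRS) p
    (Finset.notMem_erase p S)
  simpa only [marginal, insert_erase_eq_insert] using this

theorem marginal_nonneg {f : Finset P → ℝ} (hmono : Monotone f) (p : P) (R : Finset P) :
    0 ≤ marginal f p R :=
  sub_nonneg.2 (hmono ((Finset.erase_subset p R).trans (Finset.subset_insert p R)))

theorem marginal_le {f : Finset P → ℝ} (hf0 : f ∅ = 0) (hsub : IsSubmodular f) (p : P)
    (R : Finset P) : marginal f p R ≤ f {p} := by
  have := marginal_antitone hsub p (Finset.empty_subset R)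
  simpa [marginal, hf0] using this

/-- The points `s.piecewise y x` form a path from `x` to `y` that raises one coordinate at a time;
the estimates below telescope along it and need it to stay in the unit cube. -/
theorem piecewise_mem_unit {x y : P → ℝ} (hx : ∀ p, 0 ≤ x p) (hxy : ∀ p, x p ≤ y p)
    (hy : ∀ p, y p ≤ 1) (s : Finset P) :
    (∀ p, 0 ≤ s.piecewise y x p) ∧ (∀ p, s.piecewise y x p ≤ 1) ∧
      ∀ p, x p ≤ s.piecewise y x p := by
  refine ⟨fun p => ?_, fun p => ?_, fun p => ?_⟩ <;> by_cases h : p ∈ s <;>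
    simp only [Finset.piecewise_eq_of_mem, Finset.piecewise_eq_of_notMem, h, not_false_eq_true,
      le_refl] <;> linarith [hx p, hxy p, hy p]

variable [Fintype P]

/-- The multilinear extension of a set function. -/
def multilinear (g : Finset P → ℝ) (x : P → ℝ) : ℝ :=
  ∑ R : Finset P, ((∏ p ∈ R, x p) * ∏ p ∈ Rᶜ, (1 - x p)) * g R

/-- Splitting off one coordinate of the multilinear extension. -/
theorem multilinear_eq_sum_erase (g : Finset P → ℝ) (x : P → ℝ) (p : P) :
    multilinear g x = ∑ S ∈ (Finset.univ.erase p).powerset,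
      ((∏ q ∈ S, x q) * ∏ q ∈ (Finset.univ.erase p) \ S, (1 - x q)) *
        (x p * g (insert p S) + (1 - x p) * g S) := by
  have h1 : (Finset.univ : Finset (Finset P)) = (insert p (Finset.univ.erase p)).powerset := by
    rw [Finset.insert_erase (Finset.mem_univ p), Finset.powerset_univ]
  rw [multilinear, h1, Finset.sum_powerset_insert (Finset.notMem_erase p _),
    ← Finset.sum_add_distrib]
  refine Finset.sum_congr rfl fun S hS => ?_
  have hp : p ∉ S := fun h => Finset.notMem_erase p _ (Finset.mem_powerset.1 hS h)
  have h2 : Sᶜ = insert p (Finset.univ.erase p \ S) := by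
    ext q; by_cases hq : q = p <;> simp [hq, hp]
  have h3 : (insert p S)ᶜ = Finset.univ.erase p \ S := by
    ext q; by_cases hq : q = p <;> simp [hq]
  rw [h3, h2, Finset.prod_insert hp, Finset.prod_insert (by simp)]
  ring

theorem multilinear_update_of_forall (g : Finset P → ℝ) (x : P → ℝ) (p : P) (a : ℝ)
    (hg : ∀ R, g (insert p R) = g (R.erase p)) :
    multilinear g (Function.update x p a) = multilinear g x := by
  rw [multilinear_eq_sum_erase g x p, multilinear_eq_sum_erase g _ p]
  refine Finset.sum_congr rfl fun S hS => ?_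
  have hp : p ∉ S := fun h => Finset.notMem_erase p _ (Finset.mem_powerset.1 hS h)
  have e1 : ∏ q ∈ S, Function.update x p a q = ∏ q ∈ S, x q :=
    Finset.prod_congr rfl fun q hq => by
      rw [Function.update_of_ne]; rintro rfl; exact hp hq
  have e2 : ∏ q ∈ Finset.univ.erase p \ S, (1 - Function.update x p a q) =
      ∏ q ∈ Finset.univ.erase p \ S, (1 - x q) :=
    Finset.prod_congr rfl fun q hq => by
      rw [Function.update_of_ne]; rintro rfl; simp at hq
  have e3 := hg S
  rw [Finset.erase_eq_of_notMem hp] at e3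
  rw [e1, e2, e3]
  ring

theorem multilinear_split (g : Finset P → ℝ) (x : P → ℝ) (p : P) :
    multilinear g x = x p * multilinear (fun R => g (insert p R)) x +
      (1 - x p) * multilinear (fun R => g (R.erase p)) x := by
  rw [multilinear_eq_sum_erase g x p, multilinear_eq_sum_erase _ x p,
    multilinear_eq_sum_erase (fun R => g (R.erase p)) x p, Finset.mul_sum, Finset.mul_sum,
    ← Finset.sum_add_distrib]
  refine Finset.sum_congr rfl fun S hS => ?_
  have hp : p ∉ S := fun h => Finset.notMem_erase p _ (Finset.mem_powerset.1 hS h)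
  simp only [Finset.insert_idem, Finset.erase_insert hp, Finset.erase_eq_of_notMem hp]
  ring

theorem multilinear_sub (g h : Finset P → ℝ) (x : P → ℝ) :
    multilinear (fun R => g R - h R) x = multilinear g x - multilinear h x := by
  simp only [multilinear, mul_sub, Finset.sum_sub_distrib]

/-- Conditioning on membership of `p` leaves two branches that do not depend on `x p`, so the
extension is affine in this coordinate and the formula is exact. -/
theorem multilinear_update (g : Finset P → ℝ) (x : P → ℝ) (p : P) (a : ℝ) :
    multilinear g (Function.update x p a) =
      multilinear g x + (a - x p) * multilinear (marginal g p) x := by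
  have e : multilinear (marginal g p) x = multilinear (fun R => g (insert p R)) x -
    multilinear (fun R => g (R.erase p)) x := multilinear_sub _ _ x
  rw [multilinear_split g _ p, multilinear_update_of_forall _ x p a (by simp [insert_erase_eq_insert]),
    multilinear_update_of_forall (fun R => g (R.erase p)) x p a (by simp),
    multilinear_split g x p, e, Function.update_self]
  ring

theorem multilinear_weight_nonneg {x : P → ℝ} (h0 : ∀ p, 0 ≤ x p) (h1 : ∀ p, x p ≤ 1)
    (R : Finset P) : 0 ≤ (∏ p ∈ R, x p) * ∏ p ∈ Rᶜ, (1 - x p) :=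
  mul_nonneg (Finset.prod_nonneg fun p _ => h0 p)
    (Finset.prod_nonneg fun p _ => sub_nonneg.2 (h1 p))

theorem multilinear_mono {g h : Finset P → ℝ} {x : P → ℝ} (h0 : ∀ p, 0 ≤ x p)
    (h1 : ∀ p, x p ≤ 1) (hgh : ∀ R, g R ≤ h R) : multilinear g x ≤ multilinear h x :=
  Finset.sum_le_sum fun R _ =>
    mul_le_mul_of_nonneg_left (hgh R) (multilinear_weight_nonneg h0 h1 R)

theorem multilinear_const (c : ℝ) (x : P → ℝ) : multilinear (fun _ => c) x = c := by
  rw [multilinear, ← Finset.sum_mul, ← Fintype.prod_add]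
  simp

theorem multilinear_zero_right (g : Finset P → ℝ) : multilinear g (fun _ => 0) = g ∅ := by
  rw [multilinear, Finset.sum_eq_single ∅]
  · simp
  · intro R _ hR
    obtain ⟨p, hp⟩ := Finset.nonempty_iff_ne_empty.2 hR
    rw [Finset.prod_eq_zero hp rfl]; simp
  · simp

theorem multilinear_nonneg {g : Finset P → ℝ} {x : P → ℝ} (h0 : ∀ p, 0 ≤ x p)
    (h1 : ∀ p, x p ≤ 1) (hg : ∀ R, 0 ≤ g R) : 0 ≤ multilinear g x := by
  simpa [multilinear_const] using multilinear_mono (g := fun _ => 0) h0 h1 hg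

theorem multilinear_add (g h : Finset P → ℝ) (x : P → ℝ) :
    multilinear (fun R => g R + h R) x = multilinear g x + multilinear h x := by
  simp only [multilinear, mul_add, Finset.sum_add_distrib]

theorem multilinear_sum {ι : Type*} (s : Finset ι) (g : ι → Finset P → ℝ) (x : P → ℝ) :
    multilinear (fun R => ∑ i ∈ s, g i R) x = ∑ i ∈ s, multilinear (g i) x := by
  simp only [multilinear, Finset.mul_sum]
  exact Finset.sum_comm

theorem multilinear_piecewise_insert (g : Finset P → ℝ) (x y : P → ℝ) {s : Finset P} {p : P}
    (hp : p ∉ s) : multilinear g ((insert p s).piecewise y x) =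
      multilinear g (s.piecewise y x) +
        (y p - x p) * multilinear (marginal g p) (s.piecewise y x) := by
  rw [Finset.piecewise_insert, multilinear_update, Finset.piecewise_eq_of_notMem _ _ _ hp]

theorem multilinear_marginal_nonpos {h : Finset P → ℝ} (hanti : Antitone h) {x : P → ℝ}
    (hx : ∀ p, 0 ≤ x p) (hx1 : ∀ p, x p ≤ 1) (p : P) : multilinear (marginal h p) x ≤ 0 := by
  have := multilinear_mono hx hx1 (g := marginal h p) (h := fun _ => 0) fun R =>
    sub_nonpos.2 (hanti ((Finset.erase_subset p R).trans (Finset.subset_insert p R)))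
  rwa [multilinear_const] at this

theorem multilinear_piecewise_le {h : Finset P → ℝ} (hanti : Antitone h) {x y : P → ℝ}
    (hx : ∀ p, 0 ≤ x p) (hxy : ∀ p, x p ≤ y p) (hy : ∀ p, y p ≤ 1) (s : Finset P) :
    multilinear h (s.piecewise y x) ≤ multilinear h x := by
  induction s using Finset.induction_on with
  | empty => simp
  | insert p s hp ih =>
    obtain ⟨u0, u1, -⟩ := piecewise_mem_unit hx hxy hy s
    rw [multilinear_piecewise_insert h x y hp]
    nlinarith [sub_nonneg.2 (hxy p), multilinear_marginal_nonpos hanti u0 u1 p]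

/-- The multilinear extension of an antitone function with values in `[0, M]` is antitone and
`M`-Lipschitz for the sum norm. -/
theorem multilinear_antitone_lipschitz {h : Finset P → ℝ} {M : ℝ} (hanti : Antitone h)
    (h0 : ∀ R, 0 ≤ h R) (hM : ∀ R, h R ≤ M) {x y : P → ℝ} (hx : ∀ p, 0 ≤ x p)
    (hxy : ∀ p, x p ≤ y p) (hy : ∀ p, y p ≤ 1) :
    multilinear h y ≤ multilinear h x ∧
      multilinear h x ≤ multilinear h y + M * ∑ p, (y p - x p) := by
  have key : ∀ s : Finset P,
      multilinear h x ≤ multilinear h (s.piecewise y x) + M * ∑ p ∈ s, (y p - x p) := by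
    intro s
    induction s using Finset.induction_on with
    | empty => simp
    | insert p s hp ih =>
      obtain ⟨u0, u1, -⟩ := piecewise_mem_unit hx hxy hy s
      -- A difference of two values in `[0, M]` is at least `-M`.
      have a2 : -M ≤ multilinear (marginal h p) (s.piecewise y x) := by
        have := multilinear_mono u0 u1 (h := marginal h p) (g := fun _ => -M) fun R => by
          have := h0 (insert p R)
          have := hM (R.erase p)
          simp only [marginal]; linarith
        rwa [multilinear_const] at this
      rw [multilinear_piecewise_insert h x y hp, Finset.sum_insert hp]
      nlinarith [sub_nonneg.2 (hxy p)]
  exact ⟨by simpa using multilinear_piecewise_le hanti hx hxy hy Finset.univ,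
    by simpa using key Finset.univ⟩

/-- A submodular function is concave along nonnegative directions. -/
theorem multilinear_le_add_sum {g : Finset P → ℝ} (hsub : IsSubmodular g) {x y : P → ℝ}
    (hx : ∀ p, 0 ≤ x p) (hxy : ∀ p, x p ≤ y p) (hy : ∀ p, y p ≤ 1) :
    multilinear g y ≤ multilinear g x + ∑ p, (y p - x p) * multilinear (marginal g p) x := by
  have key : ∀ s : Finset P, multilinear g (s.piecewise y x) ≤
      multilinear g x + ∑ p ∈ s, (y p - x p) * multilinear (marginal g p) x := by
    intro s
    induction s using Finset.induction_on with
    | empty => simp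
    | insert p s hp ih =>
      rw [multilinear_piecewise_insert g x y hp, Finset.sum_insert hp]
      -- Slopes only decrease along the path, so each is bounded by its value at `x`.
      have := mul_le_mul_of_nonneg_left (multilinear_piecewise_le (marginal_antitone hsub p) hx hxy hy s)
        (sub_nonneg.2 (hxy p))
      linarith
  simpa using key Finset.univ

/-- Second-order lower bound for the increase of the multilinear extension when the probabilities
of the elements of `Q` grow by `c`. -/
theorem le_multilinear_add_indicator {f : Finset P → ℝ} {M : ℝ} (hmono : Monotone f)
    (hsub : IsSubmodular f) (hM : ∀ p R, marginal f p R ≤ M) {x : P → ℝ} (hx : ∀ p, 0 ≤ x p)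
    {c : ℝ} (hc : 0 ≤ c) (hM0 : 0 ≤ M) (hy : ∀ p, x p + c ≤ 1) (Q : Finset P) :
    multilinear f x + c * ∑ p ∈ Q, multilinear (marginal f p) x - c ^ 2 * M * (Q.card : ℝ) ^ 2 / 2
      ≤ multilinear f (fun p => if p ∈ Q then x p + c else x p) := by
  have hpw : ∀ s : Finset P, (fun p => if p ∈ s then x p + c else x p) =
      s.piecewise (fun p => x p + c) x := fun s => by ext p; simp [Finset.piecewise]
  simp only [hpw]
  have hxy : ∀ p, x p ≤ x p + c := fun p => by linarith
  induction Q using Finset.induction_on with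
  | empty => simp
  | insert p s hp ih =>
    obtain ⟨-, u1, u2⟩ := piecewise_mem_unit hx hxy hy s
    rw [multilinear_piecewise_insert f x _ hp, Finset.sum_insert hp,
      Finset.card_insert_of_notMem hp]
    -- After n = `s.card` coordinates have risen by `c`, the slope at `p` has dropped by at most `M
    -- * n * c`. The losses sum to the quadratic term because n²/2 + n ≤ (n+1)²/2.
    have h1 := (multilinear_antitone_lipschitz (marginal_antitone hsub p)
      (marginal_nonneg hmono p) (hM p) hx u2 u1).2
    have h2 : ∑ q, (s.piecewise (fun p => x p + c) x q - x q) = s.card * c := by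
      have : ∀ q, s.piecewise (fun p => x p + c) x q - x q = if q ∈ s then c else 0 := by
        intro q; by_cases hq : q ∈ s <;> simp [hq]
      simp [this]
    rw [h2] at h1
    have h3 := mul_le_mul_of_nonneg_left h1 hc
    push_cast
    nlinarith [mul_nonneg (sq_nonneg c) hM0]

/-- The optimality gap is at most the sum of the marginal gains of any comparison set. -/
theorem le_multilinear_add_sum_marginal {f : Finset P → ℝ} (hmono : Monotone f)
    (hsub : IsSubmodular f) {x : P → ℝ} (hx : ∀ p, 0 ≤ x p) (hx1 : ∀ p, x p ≤ 1)
    (S : Finset P) :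
    f S ≤ multilinear f x + ∑ p ∈ S, multilinear (marginal f p) x := by
  -- Add the elements of `S` to a fixed `R` one by one, bounding each gain by the gain at `R`;
  -- averaging over `R` then gives the claim.
  have key : ∀ R : Finset P, f (R ∪ S) ≤ f R + ∑ p ∈ S, marginal f p R := by
    intro R
    induction S using Finset.induction_on with
    | empty => simp
    | insert p s hp ih =>
      rw [Finset.sum_insert hp, Finset.union_insert]
      by_cases hpR : p ∈ R ∪ s
      · rw [Finset.insert_eq_of_mem hpR]
        linarith [marginal_nonneg hmono p R]
      · have h1 := hsub R (R ∪ s) Finset.subset_union_left p hpR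
        have h2 := hmono (Finset.erase_subset p R)
        simp only [marginal] at ih ⊢
        linarith
  have := multilinear_mono hx hx1 (g := fun _ => f S)
    (h := fun R => f R + ∑ p ∈ S, marginal f p R) fun R =>
      (hmono Finset.subset_union_right).trans (key R)
  rwa [multilinear_const, multilinear_add, multilinear_sum] at this

end Multilinear

/-! ### Hoeffding bounds for the sampled estimates. -/

section Concentration

theorem indep_toOuterMeasure {ι : Type*} [Fintype ι] [DecidableEq ι] {X : ι → Type*}
    [∀ i, Fintype (X i)] (μ : ∀ i, PMF (X i)) (s : ∀ i, Set (X i)) :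
    (indep μ).toOuterMeasure {x | ∀ i, x i ∈ s i} = ∏ i, (μ i).toOuterMeasure (s i) := by
  classical
  simp only [PMF.toOuterMeasure_apply_fintype]
  rw [Fintype.prod_sum]
  refine Finset.sum_congr rfl fun x _ => ?_
  by_cases hx : ∀ i, x i ∈ s i
  · rw [Set.indicator_of_mem (by exact hx)]
    simp only [Set.indicator_of_mem (hx _)]
    rfl
  · rw [Set.indicator_of_notMem (by exact hx)]
    push Not at hx
    obtain ⟨i, hi⟩ := hx
    rw [Finset.prod_eq_zero (Finset.mem_univ i) (Set.indicator_of_notMem hi _)]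

theorem one_sub_le_toOuterMeasure {X : Type*} (μ : PMF X) (s : Set X) {b : ENNReal}
    (hb : μ.toOuterMeasure sᶜ ≤ b) : 1 - b ≤ μ.toOuterMeasure s := by
  rw [tsub_le_iff_right]
  calc 1 = μ.toOuterMeasure (s ∪ sᶜ) := by
        rw [Set.union_compl_self, eq_comm, PMF.toOuterMeasure_apply_eq_one_iff]
        exact Set.subset_univ _
    _ ≤ μ.toOuterMeasure s + μ.toOuterMeasure sᶜ := MeasureTheory.measure_union_le _ _
    _ ≤ _ := by gcongr

/-- The mean of a function under a law on a finite type. -/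
def mean {X : Type*} [Fintype X] (ν : PMF X) (h : X → ℝ) : ℝ := ∑ a, (ν a).toReal * h a

theorem sum_toReal {X : Type*} [Fintype X] (ν : PMF X) : ∑ a, (ν a).toReal = 1 := by
  rw [← ENNReal.toReal_sum fun a _ => ν.apply_ne_top a,
    ← tsum_fintype (L := SummationFilter.unconditional _), ν.tsum_coe, ENNReal.toReal_one]

theorem ofReal_mean {X : Type*} [Fintype X] (ν : PMF X) {h : X → ℝ} (h0 : ∀ a, 0 ≤ h a) :
    ENNReal.ofReal (mean ν h) = ∑ a, ν a * ENNReal.ofReal (h a) := by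
  rw [mean, ENNReal.ofReal_sum_of_nonneg fun a _ => mul_nonneg ENNReal.toReal_nonneg (h0 a)]
  refine Finset.sum_congr rfl fun a _ => ?_
  rw [ENNReal.ofReal_mul ENNReal.toReal_nonneg, ENNReal.ofReal_toReal (ν.apply_ne_top a)]

/-- Hoeffding's lemma for a law on a finite type. -/
theorem mean_exp_le {X : Type*} [Fintype X] (ν : PMF X) {h : X → ℝ} {M : ℝ}
    (h0 : ∀ a, 0 ≤ h a) (hM : ∀ a, h a ≤ M) (s : ℝ) :
    mean ν (fun a => Real.exp (s * (h a - mean ν h))) ≤ Real.exp (s ^ 2 * M ^ 2 / 8) := by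
  -- With the discrete σ-algebra every function is measurable, so the general Hoeffding lemma
  -- applies.
  let _ : MeasurableSpace X := ⊤
  have := ProbabilityTheory.hasSubgaussianMGF_of_mem_Icc (μ := ν.toMeasure) (X := h) (a := 0)
    (b := M) (measurable_from_top.aemeasurable) (Filter.Eventually.of_forall fun a => ⟨h0 a, hM a⟩)
  have h2 := this.mgf_le s
  rw [ProbabilityTheory.mgf, PMF.integral_eq_sum, PMF.integral_eq_sum] at h2
  simp only [smul_eq_mul] at h2
  refine h2.trans (Real.exp_le_exp.2 (le_of_eq ?_))
  push_cast
  rw [sub_zero, Real.norm_eq_abs, div_pow, sq_abs]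
  ring

/-- Hoeffding's inequality (upper tail) for independent draws from a law on a finite type. -/
theorem hoeffding_upper {X : Type*} [Fintype X] (ν : PMF X) {h : X → ℝ} {M : ℝ} (hM0 : 0 < M)
    (h0 : ∀ a, 0 ≤ h a) (hM : ∀ a, h a ≤ M) (k : ℕ) {ε : ℝ} (hε : 0 ≤ ε) :
    (indep fun _ : Fin k => ν).toOuterMeasure
        {R | (k : ℝ) * (ε * M) < ∑ j, (h (R j) - mean ν h)} ≤
      ENNReal.ofReal (Real.exp (-2 * ε ^ 2) ^ k) := by
  classical
  -- The minimizer of -sεM + s²M²/8, with minimum -2ε².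
  set s : ℝ := 4 * ε / M with hs
  have hs0 : 0 ≤ s := by positivity
  have key : mean ν (fun a => Real.exp (s * (h a - mean ν h - ε * M))) ≤
      Real.exp (-2 * ε ^ 2) := by
    have e : ∀ a, Real.exp (s * (h a - mean ν h - ε * M)) =
        Real.exp (-(s * (ε * M))) * Real.exp (s * (h a - mean ν h)) := fun a => by
      rw [← Real.exp_add]; ring_nf
    have e2 : mean ν (fun a => Real.exp (s * (h a - mean ν h - ε * M))) =
        Real.exp (-(s * (ε * M))) * mean ν (fun a => Real.exp (s * (h a - mean ν h))) := by
      simp only [mean] at e ⊢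
      rw [Finset.mul_sum]
      exact Finset.sum_congr rfl fun a _ => by rw [e a]; ring
    rw [e2]
    refine (mul_le_mul_of_nonneg_left (mean_exp_le ν h0 hM s) (Real.exp_pos _).le).trans
      (le_of_eq ?_)
    rw [← Real.exp_add, hs]
    congr 1
    field_simp
    ring
  rw [PMF.toOuterMeasure_apply_fintype]
  -- Chernoff: on the event the product of exponentials is at least 1, and its mean factors by
  -- independence.
  calc _ ≤ ∑ R : Fin k → X, ∏ j, (ν (R j) *
          ENNReal.ofReal (Real.exp (s * (h (R j) - mean ν h - ε * M)))) := by
        refine Finset.sum_le_sum fun R _ => ?_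
        by_cases hR : R ∈ {R : Fin k → X | (k : ℝ) * (ε * M) < ∑ j, (h (R j) - mean ν h)}
        · rw [Set.indicator_of_mem hR, Finset.prod_mul_distrib,
            ← ENNReal.ofReal_prod_of_nonneg fun _ _ => (Real.exp_pos _).le, ← Real.exp_sum,
            ← Finset.mul_sum]
          refine le_mul_of_one_le_right (zero_le) ?_
          rw [ENNReal.one_le_ofReal, Real.one_le_exp_iff]
          refine mul_nonneg hs0 ?_
          have h1 : (k : ℝ) * (ε * M) < ∑ j, (h (R j) - mean ν h) := hR
          rw [Finset.sum_sub_distrib (fun j => h (R j) - mean ν h)]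
          simp only [Finset.sum_const, Finset.card_univ, Fintype.card_fin, nsmul_eq_mul]
          linarith
        · rw [Set.indicator_of_notMem hR]; exact zero_le
    _ = (∑ a, ν a * ENNReal.ofReal (Real.exp (s * (h a - mean ν h - ε * M)))) ^ k := by
        rw [← Fintype.prod_sum (fun (_ : Fin k) a =>
          ν a * ENNReal.ofReal (Real.exp (s * (h a - mean ν h - ε * M))))]
        simp
    _ = ENNReal.ofReal (mean ν fun a => Real.exp (s * (h a - mean ν h - ε * M))) ^ k := by
        rw [ofReal_mean ν fun a => (Real.exp_pos _).le]
    _ ≤ _ := by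
        rw [ENNReal.ofReal_pow (Real.exp_pos _).le]
        gcongr

/-- Hoeffding's inequality (two-sided) for the average of independent draws. -/
theorem hoeffding {X : Type*} [Fintype X] (ν : PMF X) {h : X → ℝ} {M : ℝ}
    (h0 : ∀ a, 0 ≤ h a) (hM : ∀ a, h a ≤ M) {k : ℕ} (hk : 0 < k) {ε : ℝ} (hε : 0 ≤ ε) :
    (indep fun _ : Fin k => ν).toOuterMeasure
        {R | ε * M < |(∑ j, h (R j)) / k - mean ν h|} ≤
      ENNReal.ofReal (2 * Real.exp (-2 * ε ^ 2) ^ k) := by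
  have hk' : (0 : ℝ) < k := by exact_mod_cast hk
  obtain ⟨a0, -⟩ := ν.support_nonempty
  -- For `M = 0` the Chernoff parameter is unavailable, but then `h = 0` and the strict deviation
  -- event is empty.
  rcases (le_trans (h0 a0) (hM a0)).eq_or_lt with hM0 | hM0
  · have hz : ∀ a, h a = 0 := fun a => le_antisymm (hM0 ▸ hM a) (h0 a)
    have : {R : Fin k → X | ε * M < |(∑ j, h (R j)) / k - mean ν h|} = ∅ := by
      ext R; simp [hz, mean, ← hM0]
    rw [this]
    simp
  -- The lower tail of `h` is the upper tail of `M - h`, which has the same range.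
  have hmean : mean ν (fun a => M - h a) = M - mean ν h := by
    simp only [mean, mul_sub, Finset.sum_sub_distrib, ← Finset.sum_mul, sum_toReal, one_mul]
  have hsub : {R : Fin k → X | ε * M < |(∑ j, h (R j)) / k - mean ν h|} ⊆
      {R | (k : ℝ) * (ε * M) < ∑ j, (h (R j) - mean ν h)} ∪
      {R | (k : ℝ) * (ε * M) < ∑ j, ((M - h (R j)) - mean ν fun a => M - h a)} := by
    intro R hR
    have e : (∑ j, h (R j)) / k - mean ν h = (∑ j, (h (R j) - mean ν h)) / k := by
      rw [Finset.sum_sub_distrib]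
      simp only [Finset.sum_const, Finset.card_univ, Fintype.card_fin, nsmul_eq_mul]
      field_simp
    have e2 : ∑ j, ((M - h (R j)) - mean ν fun a => M - h a) = -∑ j, (h (R j) - mean ν h) := by
      rw [hmean, ← Finset.sum_neg_distrib]
      exact Finset.sum_congr rfl fun j _ => by ring
    simp only [Set.mem_ofPred_eq, Set.mem_union, e2] at hR ⊢
    rw [e, abs_div, abs_of_pos hk', lt_div_iff₀ hk', mul_comm] at hR
    exact lt_abs.1 hR
  calc _ ≤ _ := MeasureTheory.measure_mono hsub
    _ ≤ _ := MeasureTheory.measure_union_le _ _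
    _ ≤ ENNReal.ofReal (Real.exp (-2 * ε ^ 2) ^ k) + ENNReal.ofReal (Real.exp (-2 * ε ^ 2) ^ k) :=
        add_le_add (hoeffding_upper ν hM0 h0 hM k hε)
          (hoeffding_upper ν hM0 (fun a => sub_nonneg.2 (hM a))
            (fun a => sub_le_self _ (h0 a)) k hε)
    _ = _ := by rw [← ENNReal.ofReal_add (by positivity) (by positivity), two_mul]

/-- This lets a union bound pass for a product of success probabilities. The second-order bound
gives 1 - 2md + 2(md)², at most 1 - md by the hypothesis, and d³ ≤ 1/2 finishes. The slack between d
and d⁴ is what pays for dependence within a batch. -/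
theorem one_sub_pow_le {d : ℝ} (hd : 0 ≤ d) {m : ℕ} (hm : 2 * (m : ℝ) * d ≤ 1) :
    (1 - 2 * d) ^ m ≤ 1 - m * (2 * d ^ 4) := by
  rcases Nat.eq_zero_or_pos m with rfl | hm0
  · simp
  have hm1 : (1 : ℝ) ≤ m := by exact_mod_cast hm0
  have hd2 : d ≤ 1 / 2 := by nlinarith
  have key : ∀ n : ℕ, (1 - 2 * d) ^ n ≤ 1 - 2 * n * d + 2 * (n * d) ^ 2 := by
    intro n
    induction n with
    | zero => simp
    | succ n ih =>
      rw [pow_succ]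
      have hn : (0 : ℝ) ≤ n := n.cast_nonneg
      have := mul_le_mul_of_nonneg_right ih (by linarith : 0 ≤ 1 - 2 * d)
      push_cast
      nlinarith [mul_nonneg (mul_nonneg hn hn) (pow_nonneg hd 3), sq_nonneg d]
  have h1 := key m
  have h2 : d ^ 3 ≤ 1 / 2 := by
    have : d ^ 3 ≤ (1 / 2) ^ 3 := pow_le_pow_left₀ hd hd2 3
    norm_num at this; linarith
  have hmd : 0 ≤ (m : ℝ) * d := by positivity
  nlinarith [mul_le_mul_of_nonneg_left h2 hmd]

/-- The label of any policy of the agent has m ≥ 1. Nonnegativity is needed to move products through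
`ENNReal.ofReal`. -/
theorem one_sub_two_mul_exp_nonneg {A P L : Type*} [DecidableEq L] {T : ℕ} {K : A → ℕ}
    {Pol : A → Finset P} {β : P → L}
    (hK : ∀ i l, 2 * (((Pol i).filter fun p => β p = l).card : ℝ)
      * Real.exp (-(K i : ℝ) / (8 * (T : ℝ) ^ 2)) ≤ 1) {i : A} (hne : (Pol i).Nonempty) :
    0 ≤ 1 - 2 * Real.exp (-(K i : ℝ) / (8 * (T : ℝ) ^ 2)) := by
  obtain ⟨p, hp⟩ := hne
  have h2 := hK i (β p)
  have h3 : (1 : ℝ) ≤ ((Pol i).filter fun q => β q = β p).card := by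
    exact_mod_cast Finset.card_pos.2 ⟨p, by simp [hp]⟩
  nlinarith [Real.exp_pos (-(K i : ℝ) / (8 * (T : ℝ) ^ 2))]

variable {P : Type*} [Fintype P] [DecidableEq P]

/-- On the unit cube the truncation is inactive; this makes the estimates unbiased for the slopes.
-/
theorem mean_randomSet {x : P → ℝ} (h0 : ∀ p, 0 ≤ x p) (h1 : ∀ p, x p ≤ 1)
    (g : Finset P → ℝ) : mean (randomSet x) g = multilinear g x := by
  have hc : ∀ p, clip (x p) = x p := fun p => by simp [clip, h0 p, h1 p]
  refine Finset.sum_congr rfl fun R _ => ?_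
  rw [randomSet, PMF.ofFintype_apply]
  simp only [hc]
  rw [ENNReal.toReal_ofReal (multilinear_weight_nonneg h0 h1 R)]

/-- All policies in `Q` are estimated accurately on one common batch of `k` sets. -/
theorem le_toOuterMeasure_estimate {f : Finset P → ℝ} {M : ℝ}
    (hm0 : ∀ p R, 0 ≤ marginal f p R) (hM : ∀ p R, marginal f p R ≤ M) {x : P → ℝ}
    (h0 : ∀ p, 0 ≤ x p) (h1 : ∀ p, x p ≤ 1) {T : ℕ} (hT : 1 ≤ T) (k : ℕ) (Q : Finset P)
    (hk : 2 * (Q.card : ℝ) * Real.exp (-(k : ℝ) / (8 * (T : ℝ) ^ 2)) ≤ 1) :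
    ENNReal.ofReal ((1 - 2 * Real.exp (-(k : ℝ) / (8 * (T : ℝ) ^ 2))) ^ Q.card) ≤
      (indep fun _ : Fin k => randomSet x).toOuterMeasure
        {R | ∀ p ∈ Q, |estimate f R p - multilinear (marginal f p) x| ≤ 1 / (2 * T) * M} := by
  have hT' : (0 : ℝ) < T := by exact_mod_cast hT
  set d := Real.exp (-(k : ℝ) / (8 * (T : ℝ) ^ 2)) with hd
  have hbad : (indep fun _ : Fin k => randomSet x).toOuterMeasure
      {R | ∀ p ∈ Q, |estimate f R p - multilinear (marginal f p) x| ≤ 1 / (2 * T) * M}ᶜ ≤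
      ENNReal.ofReal (Q.card * (2 * d ^ 4)) := by
    -- The policies of `Q` share their samples, so only a union bound is available.
    calc _ ≤ (indep fun _ : Fin k => randomSet x).toOuterMeasure
          (⋃ p ∈ Q, {R | 1 / (2 * T) * M < |estimate f R p - multilinear (marginal f p) x|}) := by
          refine MeasureTheory.measure_mono fun R hR => ?_
          simpa using hR
      _ ≤ ∑ p ∈ Q, _ := MeasureTheory.measure_biUnion_finset_le _ _
      _ ≤ ∑ p ∈ Q, ENNReal.ofReal (2 * d ^ 4) := by
          refine Finset.sum_le_sum fun p hp => ?_
          -- An empty batch would turn the hypothesis into 2|Q| ≤ 1, impossible once `Q` has an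
          -- element.
          have hk0 : 0 < k := by
            rcases Nat.eq_zero_or_pos k with rfl | h
            · have : (1 : ℝ) ≤ Q.card := by exact_mod_cast Finset.card_pos.2 ⟨p, hp⟩
              simp [hd] at hk
              linarith
            · exact h
          have := hoeffding (randomSet x) (hm0 p) (hM p) hk0 (ε := 1 / (2 * T)) (by positivity)
          rw [mean_randomSet h0 h1] at this
          refine this.trans (ENNReal.ofReal_le_ofReal (le_of_eq ?_))
          -- With ε = 1/(2T) the exponent -2ε²k = -k/(2T²) is four times that of `d`.
          rw [hd, ← Real.exp_nat_mul, ← Real.exp_nat_mul]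
          congr 2
          field_simp
          norm_num
      _ = _ := by
          rw [Finset.sum_const, nsmul_eq_mul, ENNReal.ofReal_mul (Nat.cast_nonneg _),
            ENNReal.ofReal_natCast]
  refine le_trans ?_ (one_sub_le_toOuterMeasure _ _ hbad)
  rw [← ENNReal.ofReal_one, ← ENNReal.ofReal_sub _ (by positivity)]
  exact ENNReal.ofReal_le_ofReal (one_sub_pow_le (Real.exp_pos _).le hk)

variable {A L : Type*} [Fintype A] [DecidableEq A] [Fintype L] [DecidableEq L]

/-- With high probability, all agents estimate the gains of all their policies accurately. -/
theorem le_drawSamples_toOuterMeasure {f : Finset P → ℝ} {M : ℝ}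
    (hm0 : ∀ p R, 0 ≤ marginal f p R) (hM : ∀ p R, marginal f p R ≤ M) {F : A → Info P}
    (h0 : ∀ i p, 0 ≤ (F i).prob p) (h1 : ∀ i p, (F i).prob p ≤ 1) {T : ℕ} (hT : 1 ≤ T)
    (K : A → ℕ) (Pol : A → Finset P) (β : P → L)
    (hK : ∀ i l, 2 * (((Pol i).filter fun p => β p = l).card : ℝ)
      * Real.exp (-(K i : ℝ) / (8 * (T : ℝ) ^ 2)) ≤ 1) (hne : ∀ i, (Pol i).Nonempty) :
    ENNReal.ofReal (∏ i, (1 - 2 * Real.exp (-(K i : ℝ) / (8 * (T : ℝ) ^ 2))) ^ (Pol i).card) ≤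
      (drawSamples (L := L) K F).toOuterMeasure {ω | ∀ i, ∀ p ∈ Pol i,
        |estimate f (ω i (β p)) p - multilinear (marginal f p) (F i).prob| ≤ 1 / (2 * T) * M} := by
  -- Grouping policies by label writes the event as a product over agents and labels, where
  -- independence holds; the fibre sizes of `β` add up to the exponent `(Pol i).card`.
  have hset : {ω : Samples P L K | ∀ i, ∀ p ∈ Pol i,
        |estimate f (ω i (β p)) p - multilinear (marginal f p) (F i).prob| ≤ 1 / (2 * T) * M} =
      {ω | ∀ i, ω i ∈ {ρ : L → Fin (K i) → Finset P | ∀ l, ρ l ∈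
        {R | ∀ p ∈ (Pol i).filter fun p => β p = l,
          |estimate f R p - multilinear (marginal f p) (F i).prob| ≤ 1 / (2 * T) * M}}} := by
    ext ω
    simp only [Set.mem_ofPred_eq, Finset.mem_filter]
    exact ⟨fun h i l p hp => hp.2 ▸ h i p hp.1, fun h i p hp => h i (β p) p ⟨hp, rfl⟩⟩
  have hd := fun i => one_sub_two_mul_exp_nonneg hK (hne i)
  rw [hset, drawSamples, indep_toOuterMeasure,
    ENNReal.ofReal_prod_of_nonneg fun i _ => pow_nonneg (hd i) _]
  refine Finset.prod_le_prod' fun i _ => ?_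
  rw [indep_toOuterMeasure, Finset.card_eq_sum_card_fiberwise (t := Finset.univ) (f := β)
    (by simp), ← Finset.prod_pow_eq_pow_sum,
    ENNReal.ofReal_prod_of_nonneg fun l _ => pow_nonneg (hd i) _]
  exact Finset.prod_le_prod' fun l _ =>
    le_toOuterMeasure_estimate hm0 hM (h0 i) (h1 i) hT (K i) _ (hK i l)

end Concentration

/-! ### Information sets and the operation MAX. -/

section InformationSets

variable {P : Type*}

/-- An information set with at most one pair per policy and nonnegative values. -/
structure Info.Lawful (F : Info P) : Prop where
  unique : ∀ p a b, (p, a) ∈ F → (p, b) ∈ F → a = b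
  nonneg : ∀ p a, (p, a) ∈ F → 0 ≤ a

theorem Info.lawful_empty : Info.Lawful (∅ : Info P) := ⟨by simp, by simp⟩

variable [DecidableEq P]

theorem Info.prob_of_mem {F : Info P} (hF : F.Lawful) {p : P} {a : ℝ} (h : (p, a) ∈ F) :
    F.prob p = a := by
  have : F.filter (fun u => u.1 = p) = {(p, a)} := by
    ext ⟨q, c⟩
    simp only [Finset.mem_filter, Finset.mem_singleton, Prod.mk.injEq]
    constructor
    · rintro ⟨h1, rfl⟩
      exact ⟨rfl, hF.unique _ _ _ h1 h⟩
    · rintro ⟨rfl, rfl⟩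
      exact ⟨h, rfl⟩
  rw [Info.prob, this, Finset.sum_singleton]

theorem Info.prob_of_notMem {F : Info P} {p : P} (h : ∀ a, (p, a) ∉ F) : F.prob p = 0 := by
  refine Finset.sum_eq_zero fun u hu => ?_
  obtain ⟨q, c⟩ := u
  rw [Finset.mem_filter] at hu
  obtain ⟨h1, rfl⟩ := hu
  exact absurd h1 (h c)

theorem Info.prob_nonneg {F : Info P} (hF : F.Lawful) (p : P) : 0 ≤ F.prob p := by
  by_cases h : ∃ a, (p, a) ∈ F
  · obtain ⟨a, ha⟩ := h
    rw [prob_of_mem hF ha]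
    exact hF.nonneg p a ha
  · push Not at h
    rw [prob_of_notMem h]

theorem Info.mem_add {F : Info P} {p q : P} {a c : ℝ} :
    (q, c) ∈ F.add p a ↔ (q ≠ p ∧ (q, c) ∈ F) ∨ (q = p ∧ ∃ b, (p, b) ∈ F ∧ c = b + a) ∨
      (q = p ∧ c = a ∧ ∀ b, (p, b) ∉ F) := by
  classical
  by_cases h : ∃ b, (p, b) ∈ F
  · simp only [Info.add, h, if_true]
    obtain ⟨b0, hb0⟩ := h
    simp only [Finset.mem_union, Finset.mem_filter, Finset.mem_image, Finset.notMem_empty]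
    grind
  · simp only [Info.add, h, if_false]
    simp only [Finset.mem_union, Finset.mem_filter, Finset.mem_image, Finset.mem_singleton]
    grind

theorem Info.Lawful.add {F : Info P} (hF : F.Lawful) (p : P) {a : ℝ} (ha : 0 ≤ a) :
    (Info.add F p a).Lawful := by
  constructor
  · intro q b c hb hc
    rw [Info.mem_add] at hb hc
    have := hF.unique
    grind
  · intro q b hb
    rw [Info.mem_add] at hb
    rcases hb with ⟨-, h⟩ | ⟨rfl, b', h, rfl⟩ | ⟨-, rfl, -⟩
    · exact hF.nonneg _ _ h
    · exact add_nonneg (hF.nonneg _ _ h) ha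
    · exact ha

theorem Info.prob_add {F : Info P} (hF : F.Lawful) (p : P) {a : ℝ} (ha : 0 ≤ a) (q : P) :
    (F.add p a).prob q = F.prob q + if q = p then a else 0 := by
  by_cases hq : q = p
  · subst hq
    rw [if_pos rfl]
    by_cases h : ∃ b, (q, b) ∈ F
    · obtain ⟨b, hb⟩ := h
      rw [prob_of_mem hF hb]
      exact prob_of_mem (hF.add q ha) (mem_add.2 (Or.inr (Or.inl ⟨rfl, b, hb, rfl⟩)))
    · push Not at h
      rw [prob_of_notMem h, zero_add]
      exact prob_of_mem (hF.add q ha) (mem_add.2 (Or.inr (Or.inr ⟨rfl, rfl, h⟩)))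
  · rw [if_neg hq, add_zero]
    by_cases h : ∃ b, (q, b) ∈ F
    · obtain ⟨b, hb⟩ := h
      rw [prob_of_mem hF hb]
      exact prob_of_mem (hF.add p ha) (mem_add.2 (Or.inl ⟨hq, hb⟩))
    · push Not at h
      rw [prob_of_notMem h]
      refine prob_of_notMem fun c hc => ?_
      rcases mem_add.1 hc with h' | h' | h'
      · exact h c h'.2
      · exact hq h'.1
      · exact hq h'.1

variable {ι : Type*} {s : Finset ι} {F : ι → Info P}

omit [DecidableEq P] in
theorem Info.mem_max {p : P} {a : ℝ} :
    (p, a) ∈ Info.max s F ↔ (∃ i ∈ s, (p, a) ∈ F i) ∧ ∀ c, (∃ i ∈ s, (p, c) ∈ F i) → c ≤ a := by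
  simp [Info.max]

omit [DecidableEq P] in
theorem Info.lawful_max (hF : ∀ i, (F i).Lawful) : (Info.max s F).Lawful := by
  constructor
  · intro p a b ha hb
    rw [mem_max] at ha hb
    exact le_antisymm (hb.2 a ha.1) (ha.2 b hb.1)
  · intro p a ha
    obtain ⟨⟨i, -, hi⟩, -⟩ := mem_max.1 ha
    exact (hF i).nonneg p a hi

omit [DecidableEq P] in
theorem Info.exists_mem_max {p : P} {a : ℝ} {i : ι} (hi : i ∈ s) (ha : (p, a) ∈ F i) :
    ∃ b, (p, b) ∈ Info.max s F := by
  classical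
  obtain ⟨u, hu, hmax⟩ := ((s.biUnion F).filter fun u => u.1 = p).exists_max_image Prod.snd
    ⟨(p, a), by simpa using ⟨i, hi, ha⟩⟩
  obtain ⟨q, b⟩ := u
  simp only [Finset.mem_filter, Finset.mem_biUnion] at hu hmax
  obtain ⟨hu1, rfl⟩ := hu
  exact ⟨b, mem_max.2 ⟨hu1, fun c hc => hmax (q, c) ⟨hc, rfl⟩⟩⟩

/-- A missing pair reads as 0, so this case rests on nonnegativity of the values. -/
theorem Info.prob_le_prob_max (hF : ∀ i, (F i).Lawful) {i : ι} (hi : i ∈ s) (p : P) :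
    (F i).prob p ≤ (Info.max s F).prob p := by
  by_cases h : ∃ a, (p, a) ∈ F i
  · obtain ⟨a, ha⟩ := h
    obtain ⟨b, hb⟩ := exists_mem_max hi ha
    rw [prob_of_mem (hF i) ha, prob_of_mem (lawful_max hF) hb]
    exact (mem_max.1 hb).2 a ⟨i, hi, ha⟩
  · push Not at h
    rw [prob_of_notMem h]
    exact prob_nonneg (lawful_max hF) p

theorem Info.exists_prob_max_eq (hF : ∀ i, (F i).Lawful) (hs : s.Nonempty) (p : P) :
    ∃ i ∈ s, (Info.max s F).prob p = (F i).prob p := by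
  by_cases h : ∃ a, (p, a) ∈ Info.max s F
  · obtain ⟨a, ha⟩ := h
    obtain ⟨i, hi, hia⟩ := (mem_max.1 ha).1
    exact ⟨i, hi, by rw [prob_of_mem (lawful_max hF) ha, prob_of_mem (hF i) hia]⟩
  · obtain ⟨i, hi⟩ := hs
    refine ⟨i, hi, ?_⟩
    rw [prob_of_notMem (not_exists.1 h), prob_of_notMem fun a ha => h (exists_mem_max hi ha)]

end InformationSets

/-! ### Consistency and lag of the information sets. -/

section Invariant

variable {A P L : Type*} [DecidableEq P]

/-- The relations between the information sets of the agents after `t` time steps. -/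
structure Invariant (G : SimpleGraph A) (Pol : A → Finset P) (T t : ℕ) (F : A → Info P) :
    Prop where
  lawful : ∀ i, (F i).Lawful
  prob_le_own : ∀ i j, ∀ p ∈ Pol j, (F i).prob p ≤ (F j).prob p
  sum_own : ∀ j, ∑ p ∈ Pol j, (F j).prob p = t * (1 / T)
  lag_le : ∀ i j (w : G.Walk i j),
    ∑ p ∈ Pol j, ((F j).prob p - (F i).prob p) ≤ w.length * (1 / T)

theorem invariant_zero (G : SimpleGraph A) (Pol : A → Finset P) (T : ℕ) :
    Invariant G Pol T 0 (fun _ => ∅) where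
  lawful _ := Info.lawful_empty
  prob_le_own _ _ _ _ := le_rfl
  sum_own _ := by simp [Info.prob]
  lag_le _ _ _ := by
    simp only [sub_self, Finset.sum_const_zero]
    positivity

theorem Invariant.own_le {G : SimpleGraph A} {Pol : A → Finset P} {T t : ℕ} {F : A → Info P}
    (h : Invariant G Pol T t F) {j : A} {p : P} (hp : p ∈ Pol j) :
    (F j).prob p ≤ t * (1 / T) := by
  rw [← h.sum_own j]
  exact Finset.single_le_sum (f := fun p => (F j).prob p)
    (fun q _ => Info.prob_nonneg (h.lawful j) q) hp

theorem Invariant.prob_le {G : SimpleGraph A} {Pol : A → Finset P}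
    (hcover : ∀ p, ∃ i, p ∈ Pol i) {T t : ℕ} {F : A → Info P}
    (h : Invariant G Pol T t F) (i : A) (p : P) : (F i).prob p ≤ t * (1 / T) := by
  obtain ⟨j, hj⟩ := hcover p
  exact (h.prob_le_own i j p hj).trans (h.own_le hj)

variable {G : SimpleGraph A} {Pol : A → Finset P} {f : Finset P → ℝ} {T : ℕ} {K : A → ℕ}
  {β : P → L} {sel : Selection Pol}

/-- The policy selected by agent `i`. -/
noncomputable def selected (f : Finset P → ℝ) (β : P → L) (sel : Selection Pol) (t : ℕ) (ω : Samples P L K)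
    (i : A) : P :=
  sel t i fun p => estimate f (ω i (β p)) p

theorem selected_mem (t : ℕ) (ω : Samples P L K) (i : A) : selected f β sel t ω i ∈ Pol i :=
  Subtype.prop _

theorem lawful_propagate {t : ℕ} {F : A → Info P} (hF : ∀ i, (F i).Lawful)
    (ω : Samples P L K) (i : A) : (propagate Pol f T K β sel t F ω i).Lawful :=
  (hF i).add _ (by positivity)

theorem prob_propagate {t : ℕ} {F : A → Info P} (hF : ∀ i, (F i).Lawful)
    (ω : Samples P L K) (i : A) (p : P) : (propagate Pol f T K β sel t F ω i).prob p =
      (F i).prob p + if p = selected f β sel t ω i then 1 / (T : ℝ) else 0 :=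
  Info.prob_add (hF i) _ (by positivity) p

theorem prob_le_prob_propagate {t : ℕ} {F : A → Info P} (hF : ∀ i, (F i).Lawful)
    (ω : Samples P L K) (i : A) (p : P) :
    (F i).prob p ≤ (propagate Pol f T K β sel t F ω i).prob p := by
  rw [prob_propagate hF, le_add_iff_nonneg_right]
  split_ifs <;> positivity

theorem prob_propagate_of_ne (hdisj : ∀ i j, i ≠ j → Disjoint (Pol i) (Pol j))
    {t : ℕ} {F : A → Info P} (hF : ∀ i, (F i).Lawful) (ω : Samples P L K) {i j : A} (hij : i ≠ j)
    {p : P} (hp : p ∈ Pol j) :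
    (propagate Pol f T K β sel t F ω i).prob p = (F i).prob p := by
  rw [prob_propagate hF, if_neg, add_zero]
  rintro rfl
  exact Finset.disjoint_left.1 (hdisj i j hij) (selected_mem t ω i) hp

/-- Only agent `j` ever raises policies of `Pol j`, so every other value for them is an outdated
copy of its own. -/
theorem prob_le_prob_propagate_own (hdisj : ∀ i j, i ≠ j → Disjoint (Pol i) (Pol j))
    {t : ℕ} {F : A → Info P} (h : Invariant G Pol T t F) (ω : Samples P L K) (k : A) {j : A}
    {p : P} (hp : p ∈ Pol j) : (propagate Pol f T K β sel t F ω k).prob p ≤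
      (propagate Pol f T K β sel t F ω j).prob p := by
  rcases eq_or_ne k j with rfl | hk
  · exact le_rfl
  · rw [prob_propagate_of_ne hdisj h.lawful ω hk hp]
    exact (h.prob_le_own k j p hp).trans (prob_le_prob_propagate h.lawful ω j p)

theorem sum_selected_indicator (t : ℕ) (ω : Samples P L K) (j : A) (c : ℝ) :
    ∑ p ∈ Pol j, (if p = selected f β sel t ω j then c else 0) = c := by
  rw [Finset.sum_ite_eq', if_pos (selected_mem t ω j)]

variable [Fintype A] [DecidableEq A]

omit [DecidableEq P] in
theorem mem_closedNbhd {G : SimpleGraph A} {i j : A} :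
    j ∈ closedNbhd G i ↔ j = i ∨ G.Adj i j := by
  simp [closedNbhd]

/-- `MAX` does not change the probabilities that an agent assigns to its own policies. -/
theorem prob_step_own (hdisj : ∀ i j, i ≠ j → Disjoint (Pol i) (Pol j))
    {t : ℕ} {F : A → Info P} (h : Invariant G Pol T t F) (ω : Samples P L K) {j : A} {p : P}
    (hp : p ∈ Pol j) : (step G Pol f T K β sel t F ω j).prob p =
      (F j).prob p + if p = selected f β sel t ω j then 1 / (T : ℝ) else 0 := by
  have hj : j ∈ closedNbhd G j := mem_closedNbhd.2 (Or.inl rfl)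
  have hl := lawful_propagate (f := f) (T := T) (β := β) (sel := sel) (t := t) h.lawful ω
  rw [← prob_propagate h.lawful ω j p]
  refine le_antisymm ?_ (Info.prob_le_prob_max hl hj p)
  obtain ⟨k, -, hk⟩ := Info.exists_prob_max_eq hl ⟨j, hj⟩ p
  exact hk.le.trans (prob_le_prob_propagate_own hdisj h ω k hp)

/-- For the lag, take the first neighbor `k` on the walk from `i` to `j`. MAX gives `i` at least
what `k` knew before the step, while the owner `j` gained 1/T; so the old lag along the shorter walk
grows by one unit, matching the extra edge. -/
theorem Invariant.step (hdisj : ∀ i j, i ≠ j → Disjoint (Pol i) (Pol j))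
    {t : ℕ} {F : A → Info P} (h : Invariant G Pol T t F) (ω : Samples P L K) :
    Invariant G Pol T (t + 1) (DistGreedy.step G Pol f T K β sel t F ω) := by
  have hl := lawful_propagate (f := f) (T := T) (β := β) (sel := sel) (t := t) h.lawful ω
  have hown : ∀ {j : A} {p : P}, p ∈ Pol j → (DistGreedy.step G Pol f T K β sel t F ω j).prob p =
      (propagate Pol f T K β sel t F ω j).prob p := fun hp => by
    rw [prob_step_own hdisj h ω hp, prob_propagate h.lawful]
  refine ⟨fun i => Info.lawful_max hl, fun i j p hp => ?_, fun j => ?_, fun i j w => ?_⟩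
  · obtain ⟨k, -, hk⟩ := Info.exists_prob_max_eq hl
      ⟨i, mem_closedNbhd (G := G).2 (Or.inl rfl)⟩ p
    rw [hown hp]
    exact hk.le.trans (prob_le_prob_propagate_own hdisj h ω k hp)
  · rw [Finset.sum_congr rfl fun p hp => prob_step_own hdisj h ω hp, Finset.sum_add_distrib,
      h.sum_own, sum_selected_indicator]
    push_cast
    ring
  · cases w with
    | nil => simp
    | @cons _ k _ hik w =>
      have hk : k ∈ closedNbhd G i := mem_closedNbhd.2 (Or.inr hik)
      calc _ ≤ ∑ p ∈ Pol j, (((F j).prob p - (F k).prob p) +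
            if p = selected f β sel t ω j then 1 / (T : ℝ) else 0) := by
            refine Finset.sum_le_sum fun p hp => ?_
            rw [prob_step_own hdisj h ω hp]
            have := (prob_le_prob_propagate (f := f) (T := T) (β := β) (sel := sel) (t := t)
              h.lawful ω k p).trans (Info.prob_le_prob_max hl hk p)
            change (F k).prob p ≤ (DistGreedy.step G Pol f T K β sel t F ω i).prob p at this
            linarith
        _ ≤ _ := by
            rw [Finset.sum_add_distrib, sum_selected_indicator, SimpleGraph.Walk.length_cons]
            have := h.lag_le k j w
            push_cast
            linarith

variable [Fintype P] [Fintype L] [DecidableEq L]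

theorem Invariant.of_mem_support (hdisj : ∀ i j, i ≠ j → Disjoint (Pol i) (Pol j)) {t : ℕ}
    {F : A → Info P} (hF : F ∈ (run G Pol f T K β sel t).support) : Invariant G Pol T t F := by
  induction t generalizing F with
  | zero =>
    rw [run, PMF.mem_support_pure_iff] at hF
    exact hF ▸ invariant_zero G Pol T
  | succ t ih =>
    rw [run, PMF.mem_support_bind_iff] at hF
    obtain ⟨F', hF', hF⟩ := hF
    rw [PMF.mem_support_map_iff] at hF
    obtain ⟨ω, -, rfl⟩ := hF
    exact (ih hF').step hdisj ω

end Invariant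

/-! ### Growth of the multilinear extension per time step. -/

section Progress

variable {A P : Type*} [DecidableEq P]

/-- The probabilities that all agents assign to their own policies. -/
def ownProb (own : P → A) (F : A → Info P) (p : P) : ℝ := (F (own p)).prob p

variable {Pol : A → Finset P}

omit [DecidableEq P] in
theorem owner_eq (hdisj : ∀ i j, i ≠ j → Disjoint (Pol i) (Pol j)) {own : P → A}
    (hown : ∀ p, p ∈ Pol (own p)) {i : A} {p : P} (hp : p ∈ Pol i) : own p = i := by
  by_contra h
  exact Finset.disjoint_left.1 (hdisj _ _ h) (hown p) hp

theorem sum_eq_sum_inter [Fintype A] (hdisj : ∀ i j, i ≠ j → Disjoint (Pol i) (Pol j))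
    (hcover : ∀ p, ∃ i, p ∈ Pol i) (S : Finset P) (g : P → ℝ) :
    ∑ p ∈ S, g p = ∑ i, ∑ p ∈ S ∩ Pol i, g p := by
  classical
  rw [← Finset.sum_biUnion]
  · refine Finset.sum_congr ?_ fun _ _ => rfl
    ext p
    simpa using fun _ => hcover p
  · intro i _ j _ hij
    exact (hdisj i j hij).mono Finset.inter_subset_right Finset.inter_subset_right

/-- Together with `marginal_le`, this makes the optimal value a bound on all marginal gains, so
every error is relative to it. -/
theorem IsOptimizer.singleton_le {f : Finset P → ℝ} {S : Finset P} (h : IsOptimizer Pol f S)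
    (p : P) : f {p} ≤ f S :=
  h.2 _ fun i => (Finset.card_le_card Finset.inter_subset_left).trans (by simp)

variable {G : SimpleGraph A} {T t : ℕ} {F : A → Info P}

theorem Invariant.ownProb_bounds (h : Invariant G Pol T t F) {own : P → A}
    (hown : ∀ p, p ∈ Pol (own p)) (i : A) (p : P) :
    0 ≤ (F i).prob p ∧ (F i).prob p ≤ ownProb own F p ∧ ownProb own F p ≤ t * (1 / T) :=
  ⟨Info.prob_nonneg (h.lawful i) p, h.prob_le_own i _ p (hown p), h.own_le (hown p)⟩

variable [Fintype A] [Fintype P]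

omit [Fintype A] in
theorem multilinear_ownProb_empty {f : Finset P → ℝ} (hf0 : f ∅ = 0) (own : P → A) :
    multilinear f (ownProb own fun _ => ∅) = 0 := by
  have : ownProb own (fun _ => (∅ : Info P)) = fun _ => 0 := by
    ext p; simp [ownProb, Info.prob]
  rw [this, multilinear_zero_right, hf0]

/-- A shortest walk to each owner bounds the lag on its policies by d/T; summing over owners gives
the factor N. -/
theorem Invariant.sum_lag_le (hG : G.Connected)
    (hdisj : ∀ i j, i ≠ j → Disjoint (Pol i) (Pol j)) (h : Invariant G Pol T t F) {own : P → A}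
    (hown : ∀ p, p ∈ Pol (own p)) (i : A) :
    ∑ p, (ownProb own F p - (F i).prob p) ≤ Fintype.card A * (G.diam * (1 / T)) := by
  rw [sum_eq_sum_inter hdisj fun p => ⟨own p, hown p⟩]
  calc _ ≤ ∑ _j : A, (G.diam * (1 / T) : ℝ) := by
        refine Finset.sum_le_sum fun j _ => ?_
        obtain ⟨w, hw⟩ := hG.exists_walk_length_eq_dist i j
        rw [Finset.univ_inter, Finset.sum_congr rfl fun p hp => by
          rw [ownProb, owner_eq hdisj hown hp]]
        refine (h.lag_le i j w).trans ?_
        have : Nonempty A := ⟨i⟩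
        have := SimpleGraph.dist_le_diam (SimpleGraph.connected_iff_ediam_ne_top.1 hG)
          (u := i) (v := j)
        rw [hw]
        gcongr
    _ = _ := by simp

variable {L : Type*} {f : Finset P → ℝ} {K : A → ℕ} {β : P → L} {sel : Selection Pol}

/-- The selected policy has nearly the largest marginal gain. -/
theorem Invariant.marginal_le_selected (hG : G.Connected)
    (hdisj : ∀ i j, i ≠ j → Disjoint (Pol i) (Pol j)) (hmono : Monotone f)
    (hsub : IsSubmodular f) {M : ℝ} (hM : ∀ p R, marginal f p R ≤ M) (hM0 : 0 ≤ M)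
    (hsel : sel.IsArgmax) (h : Invariant G Pol T t F) (ht : t ≤ T) (hT : 1 ≤ T) {own : P → A}
    (hown : ∀ p, p ∈ Pol (own p)) {ω : Samples P L K} {i : A}
    (hω : ∀ p ∈ Pol i,
      |estimate f (ω i (β p)) p - multilinear (marginal f p) (F i).prob| ≤ 1 / (2 * T) * M)
    {s : P} (hs : s ∈ Pol i) :
    multilinear (marginal f s) (ownProb own F) ≤
      multilinear (marginal f (selected f β sel t ω i)) (ownProb own F) +
        M * (Fintype.card A * (G.diam * (1 / T))) + 1 / T * M := by
  have hT' : (0 : ℝ) < T := by exact_mod_cast hT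
  have hx1 : ∀ p, ownProb own F p ≤ 1 := fun p => by
    refine (h.ownProb_bounds hown i p).2.2.trans ?_
    rw [mul_one_div, div_le_one hT']
    exact_mod_cast ht
  -- The local vector lies below `ownProb`. Antitonicity therefore moves the gain of `s` to it at no
  -- cost, and only the selected policy pays the Lipschitz price of the lag.
  have key := fun q => multilinear_antitone_lipschitz (marginal_antitone hsub q)
    (marginal_nonneg hmono q) (hM q) (fun p => (h.ownProb_bounds hown i p).1)
    (fun p => (h.ownProb_bounds hown i p).2.1) hx1
  have h1 := (key s).1
  have h2 := (key (selected f β sel t ω i)).2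
  have h3 := abs_le.1 (hω s hs)
  have h4 := abs_le.1 (hω _ (selected_mem t ω i : selected f β sel t ω i ∈ Pol i))
  have h5 : estimate f (ω i (β s)) s ≤
      estimate f (ω i (β (selected f β sel t ω i))) (selected f β sel t ω i) :=
    hsel t i (fun p => estimate f (ω i (β p)) p) ⟨s, hs⟩
  have h6 := mul_le_mul_of_nonneg_left (h.sum_lag_le hG hdisj hown i) hM0
  have h7 : 1 / (2 * (T : ℝ)) * M + 1 / (2 * T) * M = 1 / T * M := by
    field_simp
    ring
  linarith [h3.1, h4.2]

variable [DecidableEq A]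

/-- The increase of the multilinear extension in one time step with accurate estimates. -/
theorem Invariant.progress (hG : G.Connected)
    (hdisj : ∀ i j, i ≠ j → Disjoint (Pol i) (Pol j)) (hf0 : f ∅ = 0) (hmono : Monotone f)
    (hsub : IsSubmodular f) {S : Finset P} (hopt : IsOptimizer Pol f S)
    (hsel : sel.IsArgmax) (h : Invariant G Pol T t F) (ht : t + 1 ≤ T) {own : P → A}
    (hown : ∀ p, p ∈ Pol (own p)) {ω : Samples P L K}
    (hω : ∀ i, ∀ p ∈ Pol i,
      |estimate f (ω i (β p)) p - multilinear (marginal f p) (F i).prob| ≤ 1 / (2 * T) * f S) :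
    multilinear f (ownProb own F) * (1 - 1 / T) +
      (1 - (2 * (Fintype.card A : ℝ) ^ 2 * (G.diam : ℝ) + (Fintype.card A : ℝ) ^ 2 / 2
        + (Fintype.card A : ℝ)) * (1 / (T : ℝ))) * f S * (1 / T) ≤
      multilinear f (ownProb own (DistGreedy.step G Pol f T K β sel t F ω)) := by
  have hT : 1 ≤ T := le_trans (Nat.le_add_left 1 t) ht
  have hT' : (0 : ℝ) < T := by exact_mod_cast hT
  have hM : ∀ p R, marginal f p R ≤ f S := fun p R =>
    (marginal_le hf0 hsub p R).trans (hopt.singleton_le p)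
  have hM0 : 0 ≤ f S := hf0 ▸ hmono (Finset.empty_subset S)
  have hx0 : ∀ p, 0 ≤ ownProb own F p := fun p => (h.ownProb_bounds hown (own p) p).1
  have hxc : ∀ p, ownProb own F p + 1 / T ≤ 1 := fun p => by
    have h1 := (h.ownProb_bounds hown (own p) p).2.2
    have h2 : ((t : ℝ) + 1) * (1 / T) ≤ 1 := by
      rw [mul_one_div, div_le_one hT']
      exact_mod_cast ht
    linarith
  have hc : (0 : ℝ) ≤ 1 / T := by positivity
  have hx1 : ∀ p, ownProb own F p ≤ 1 := fun p => by linarith [hxc p]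
  -- Disjointness makes the selections distinct, so exactly N coordinates rise.
  have hinj : Function.Injective (selected f β sel t ω) := fun i j hij => by
    rw [← owner_eq hdisj hown (selected_mem t ω i : selected f β sel t ω i ∈ Pol i), hij,
      owner_eq hdisj hown (selected_mem t ω j)]
  set Q : Finset P := Finset.univ.image (selected f β sel t ω) with hQ
  have hstep : ownProb own (DistGreedy.step G Pol f T K β sel t F ω) =
      fun p => if p ∈ Q then ownProb own F p + 1 / T else ownProb own F p := by
    ext p
    have hmem : p ∈ Q ↔ p = selected f β sel t ω (own p) := by
      simp only [hQ, Finset.mem_image, Finset.mem_univ, true_and]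
      constructor
      · rintro ⟨i, rfl⟩
        rw [owner_eq hdisj hown (selected_mem t ω i)]
      · exact fun hp => ⟨own p, hp.symm⟩
    rw [ownProb, prob_step_own hdisj h ω (hown p)]
    simp only [hmem]
    split_ifs <;> simp [ownProb]
  have hsecond := le_multilinear_add_indicator hmono hsub hM hx0 hc hM0 hxc Q
  rw [← hstep, hQ, Finset.sum_image hinj.injOn, Finset.card_image_of_injective _ hinj,
    Finset.card_univ] at hsecond
  have hgap := le_multilinear_add_sum_marginal hmono hsub hx0 hx1 S
  have hsum : ∑ p ∈ S, multilinear (marginal f p) (ownProb own F) ≤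
      (∑ i, multilinear (marginal f (selected f β sel t ω i)) (ownProb own F)) +
        Fintype.card A * (f S * (Fintype.card A * (G.diam * (1 / T))) + 1 / T * f S) := by
    rw [sum_eq_sum_inter hdisj fun p => ⟨own p, hown p⟩]
    calc _ ≤ ∑ i, (multilinear (marginal f (selected f β sel t ω i)) (ownProb own F) +
          (f S * (Fintype.card A * (G.diam * (1 / T))) + 1 / T * f S)) := by
          refine Finset.sum_le_sum fun i _ => ?_
          -- The optimizer holds at most one policy of each agent; where it holds none, nonnegative
          -- gains suffice.
          rcases Finset.eq_empty_or_nonempty (S ∩ Pol i) with he | ⟨s, hs⟩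
          · rw [he, Finset.sum_empty]
            have := multilinear_nonneg hx0 hx1 (marginal_nonneg hmono (selected f β sel t ω i))
            positivity
          · have : S ∩ Pol i = {s} :=
              Finset.eq_singleton_iff_unique_mem.2 ⟨hs, fun q hq =>
                Finset.card_le_one.1 (hopt.1 i) q hq s hs⟩
            rw [this, Finset.sum_singleton, ← add_assoc]
            exact h.marginal_le_selected hG hdisj hmono hsub hM hM0 hsel (by omega) hT hown
              (hω i) (Finset.mem_inter.1 hs).2
      _ = _ := by
          rw [Finset.sum_add_distrib, Finset.sum_const, Finset.card_univ, nsmul_eq_mul]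
  have h1 := mul_le_mul_of_nonneg_left (hgap.trans (add_le_add_right hsum _)) hc
  -- The lag produces N²d only once; the second N²d in the stated constant is slack, discarded here.
  have h2 : 0 ≤ (1 / T : ℝ) ^ 2 * f S * ((Fintype.card A : ℝ) ^ 2 * G.diam) := by positivity
  nlinarith

variable [Fintype L] [DecidableEq L]

/-- The utility guarantee after `t` time steps, in terms of the multilinear extension. -/
theorem le_run_toOuterMeasure (hG : G.Connected) (hne : ∀ i, (Pol i).Nonempty)
    (hdisj : ∀ i j, i ≠ j → Disjoint (Pol i) (Pol j)) (hf0 : f ∅ = 0) (hmono : Monotone f)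
    (hsub : IsSubmodular f) {S : Finset P} (hopt : IsOptimizer Pol f S)
    (hK : ∀ i l, 2 * (((Pol i).filter fun p => β p = l).card : ℝ)
      * Real.exp (-(K i : ℝ) / (8 * (T : ℝ) ^ 2)) ≤ 1)
    (hsel : sel.IsArgmax) {own : P → A} (hown : ∀ p, p ∈ Pol (own p)) (t : ℕ) (ht : t ≤ T) :
    ENNReal.ofReal
        (∏ i, (1 - 2 * Real.exp (-(K i : ℝ) / (8 * (T : ℝ) ^ 2))) ^ (Pol i).card) ^ t ≤
      (run G Pol f T K β sel t).toOuterMeasure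
        {F | (1 - (1 - 1 / T) ^ t) * ((1 - (2 * (Fintype.card A : ℝ) ^ 2 * (G.diam : ℝ)
          + (Fintype.card A : ℝ) ^ 2 / 2 + (Fintype.card A : ℝ)) * (1 / (T : ℝ))) * f S) ≤
            multilinear f (ownProb own F)} := by
  classical
  induction t with
  | zero =>
    simp only [pow_zero, sub_self, zero_mul, run]
    rw [PMF.toOuterMeasure_pure_apply, if_pos]
    exact (multilinear_ownProb_empty hf0 own).ge
  | succ t ih =>
    have hT : 1 ≤ T := le_trans (Nat.le_add_left 1 t) ht
    have hT' : (0 : ℝ) < T := by exact_mod_cast hT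
    have hc : (1 / T : ℝ) ≤ 1 := by
      rw [div_le_one hT']
      exact_mod_cast hT
    rw [run, PMF.toOuterMeasure_bind_apply, pow_succ]
    refine (mul_le_mul_left (ih (by omega)) _).trans ?_
    rw [PMF.toOuterMeasure_apply, ← ENNReal.tsum_mul_right]
    refine ENNReal.tsum_le_tsum fun F => ?_
    -- The invariant is known only on the support; other states carry no mass. Among the rest, only
    -- states that already meet the bound are counted.
    by_cases hF : F ∈ (run G Pol f T K β sel t).support
    swap
    · rw [PMF.mem_support_iff, not_not] at hF
      simp [Set.indicator_apply, hF]
    by_cases hgood : (1 - (1 - 1 / T) ^ t) * ((1 - (2 * (Fintype.card A : ℝ) ^ 2 * (G.diam : ℝ)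
          + (Fintype.card A : ℝ) ^ 2 / 2 + (Fintype.card A : ℝ)) * (1 / (T : ℝ))) * f S) ≤
            multilinear f (ownProb own F)
    swap
    · rw [Set.indicator_of_notMem (by exact hgood), zero_mul]
      exact zero_le
    rw [Set.indicator_of_mem (by exact hgood), PMF.toOuterMeasure_map_apply]
    have hI := Invariant.of_mem_support hdisj hF
    have h1 : ∀ i p, (F i).prob p ≤ 1 := fun i p => by
      refine (hI.prob_le (fun p => ⟨own p, hown p⟩) i p).trans ?_
      rw [mul_one_div, div_le_one hT']
      exact_mod_cast (by omega : t ≤ T)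
    refine mul_le_mul_right ((le_drawSamples_toOuterMeasure (marginal_nonneg hmono)
      (fun p R => (marginal_le hf0 hsub p R).trans (hopt.singleton_le p))
      (fun i => Info.prob_nonneg (hI.lawful i)) h1 hT K Pol β hK hne).trans
      (MeasureTheory.measure_mono fun ω hω => ?_)) _
    have := hI.progress hG hdisj hf0 hmono hsub hopt hsel ht hown hω
    refine le_trans ?_ this
    -- With a_t = 1 - (1 - 1/T)^t one has a_{t+1} = (1 - 1/T) a_t + 1/T, the shape of the progress
    -- bound.
    have h2 := mul_le_mul_of_nonneg_right hgood (sub_nonneg.2 hc)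
    refine le_trans (le_of_eq ?_) (add_le_add_left h2 _)
    rw [pow_succ]
    ring

end Progress

/-! ### From the multilinear extension to sampled policies. -/

section Rounding

theorem mean_mono {X : Type*} [Fintype X] (ν : PMF X) {g h : X → ℝ} (hgh : ∀ a, g a ≤ h a) :
    mean ν g ≤ mean ν h :=
  Finset.sum_le_sum fun a _ => mul_le_mul_of_nonneg_left (hgh a) ENNReal.toReal_nonneg

theorem mean_const {X : Type*} [Fintype X] (ν : PMF X) (c : ℝ) : mean ν (fun _ => c) = c := by
  rw [mean, ← Finset.sum_mul, sum_toReal, one_mul]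

theorem mean_map {X Y : Type*} [Fintype X] [Fintype Y] (ν : PMF X) (φ : X → Y) (g : Y → ℝ) :
    mean (ν.map φ) g = mean ν (g ∘ φ) := by
  classical
  have h : ∀ y, (ν.map φ y).toReal = ∑ a, if y = φ a then (ν a).toReal else 0 := by
    intro y
    rw [PMF.map_apply, tsum_fintype, ENNReal.toReal_sum]
    · exact Finset.sum_congr rfl fun a _ => by split_ifs <;> simp
    · intro a _
      split_ifs
      exacts [ν.apply_ne_top a, ENNReal.zero_ne_top]
  simp only [mean, h, Finset.sum_mul]
  rw [Finset.sum_comm]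
  refine Finset.sum_congr rfl fun a _ => ?_
  simp [ite_mul]

/-- Drawing one coordinate of an independent family again does not change the law. -/
theorem mean_indep_update {ι : Type*} [Fintype ι] [DecidableEq ι] {X : Type*} [Fintype X]
    (μ : ι → PMF X) (j : ι) (H : (ι → X) → ℝ) :
    mean (indep μ) (fun s => mean (μ j) fun a => H (Function.update s j a)) =
      mean (indep μ) H := by
  have hw : ∀ s : ι → X, (indep μ s).toReal = ∏ i, (μ i (s i)).toReal := fun s => by
    rw [← ENNReal.toReal_prod]; rfl
  have hsplit : ∀ s : ι → X, (indep μ s).toReal =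
      (μ j (s j)).toReal * ∏ i ∈ Finset.univ.erase j, (μ i (s i)).toReal := fun s => by
    rw [hw, Finset.mul_prod_erase _ (fun i => (μ i (s i)).toReal) (Finset.mem_univ j)]
  -- Swapping coordinate `j` with the fresh draw is an involution that preserves the joint weight.
  let e : (ι → X) × X → (ι → X) × X := fun u => (Function.update u.1 j u.2, u.1 j)
  have he : Function.Involutive e := fun u => by simp [e]
  calc _ = ∑ u : (ι → X) × X, (indep μ u.1).toReal * (μ j u.2).toReal *
          H (Function.update u.1 j u.2) := by
        rw [Fintype.sum_prod_type]
        simp only [mean, Finset.mul_sum, mul_assoc]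
    _ = ∑ u : (ι → X) × X, (indep μ u.1).toReal * (μ j u.2).toReal * H u.1 := by
        refine Fintype.sum_equiv he.toPerm _ _ fun u => ?_
        have : ∏ i ∈ Finset.univ.erase j, (μ i (Function.update u.1 j u.2 i)).toReal =
            ∏ i ∈ Finset.univ.erase j, (μ i (u.1 i)).toReal :=
          Finset.prod_congr rfl fun i hi => by
            rw [Function.update_of_ne (Finset.ne_of_mem_erase hi)]
        simp only [Function.Involutive.coe_toPerm, e, hsplit, this, Function.update_self]
        ring
    _ = _ := by
        rw [Fintype.sum_prod_type]
        refine Finset.sum_congr rfl fun s _ => ?_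
        dsimp only
        rw [← Finset.sum_mul, ← Finset.mul_sum, sum_toReal, mul_one]

variable {P : Type*} [DecidableEq P]

/-- Once some agents have sampled `S`, the remaining agents face this function. -/
theorem IsSubmodular.union_right {f : Finset P → ℝ} (hf : IsSubmodular f) (S : Finset P) :
    IsSubmodular fun R => f (R ∪ S) := by
  intro S₁ S₂ h p hp
  by_cases hpS : p ∈ S
  · have e : ∀ R : Finset P, insert p R ∪ S = R ∪ S := fun R => by
      rw [Finset.insert_union, Finset.insert_eq_of_mem (Finset.mem_union_right R hpS)]
    simp [e]
  · simp only [Finset.insert_union]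
    exact hf _ _ (Finset.union_subset_union_left h) p (by simp [hp, hpS])

variable {A : Type*} [Fintype A] [DecidableEq A] [Fintype P] {Pol : A → Finset P}

/-- Rounding one agent: sampling one of its policies is at least as good as including its policies
independently. -/
theorem multilinear_le_sum_insert {g : Finset P → ℝ} (hg : IsSubmodular g) {x y : P → ℝ}
    (hy0 : ∀ p, 0 ≤ y p) (hx1 : ∀ p, x p ≤ 1) {Q : Finset P} (hQ : ∀ p ∈ Q, y p = 0)
    (hQ' : ∀ p ∉ Q, y p = x p) (hx0 : ∀ p, 0 ≤ x p) (hsum : ∑ p ∈ Q, x p = 1) :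
    multilinear g x ≤ ∑ p ∈ Q, x p * multilinear (fun R => g (insert p R)) y := by
  have hyx : ∀ p, y p ≤ x p := fun p => by
    by_cases hp : p ∈ Q
    · rw [hQ p hp]; exact hx0 p
    · rw [hQ' p hp]
  -- Concavity puts F(x) below the linearization at `y`. As `y` vanishes on `Q`, each slope is F(y
  -- with `p` inserted) - F(y), and total mass 1 cancels the F(y) terms.
  refine (multilinear_le_add_sum hg hy0 hyx hx1).trans (le_of_eq ?_)
  have h1 : ∑ p, (x p - y p) * multilinear (marginal g p) y =
      ∑ p ∈ Q, (x p * multilinear (fun R => g (insert p R)) y - x p * multilinear g y) := by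
    rw [← Finset.sum_subset (Finset.subset_univ Q) fun p _ hp => by rw [hQ' p hp]; ring]
    refine Finset.sum_congr rfl fun p hp => ?_
    have h2 := multilinear_split g y p
    have h3 : multilinear (marginal g p) y = multilinear (fun R => g (insert p R)) y -
      multilinear (fun R => g (R.erase p)) y := multilinear_sub _ _ y
    rw [hQ p hp, zero_mul, sub_zero, one_mul, zero_add] at h2
    rw [h3, ← h2, hQ p hp]
    ring
  rw [h1, Finset.sum_sub_distrib, ← Finset.sum_mul, hsum]
  ring

/-- Rounding: independent sampling of one policy per agent does not decrease the value of the
multilinear extension. -/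
theorem multilinear_le_mean_indep (hdisj : ∀ i j, i ≠ j → Disjoint (Pol i) (Pol j))
    {f : Finset P → ℝ} (hsub : IsSubmodular f) {x : P → ℝ} (hx0 : ∀ p, 0 ≤ x p)
    (hx1 : ∀ p, x p ≤ 1) (hsum : ∀ i, ∑ p ∈ Pol i, x p = 1) {own : P → A}
    (hown : ∀ p, p ∈ Pol (own p)) {μ : A → PMF (Finset P)}
    (hμ : ∀ i g, mean (μ i) g = ∑ p ∈ Pol i, x p * g {p}) :
    multilinear f x ≤ mean (indep μ) fun s => f (Finset.univ.biUnion s) := by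
  -- Hybrid argument: agents in `B` have sampled one policy each, the policies of the others are
  -- still included independently.
  have key : ∀ B : Finset A, multilinear f x ≤ mean (indep μ) fun s =>
      multilinear (fun R => f (R ∪ B.biUnion s)) fun p => if own p ∈ B then 0 else x p := by
    intro B
    induction B using Finset.induction_on with
    | empty => simp [mean_const]
    | insert j B hj ih =>
      -- Redrawing coordinate `j` exposes the average over the choice of agent `j` with the others
      -- fixed.
      rw [← mean_indep_update μ j]
      refine ih.trans (mean_mono _ fun s => ?_)
      have hU : ∀ a, (insert j B).biUnion (Function.update s j a) = a ∪ B.biUnion s := fun a => by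
        rw [Finset.biUnion_insert, Function.update_self]
        congr 1
        refine Finset.biUnion_congr rfl fun i hi => ?_
        rw [Function.update_of_ne]
        rintro rfl
        exact hj hi
      have hx : ∀ p ∈ Pol j, (if own p ∈ B then 0 else x p) = x p := fun p hp => by
        rw [owner_eq hdisj hown hp, if_neg hj]
      have := multilinear_le_sum_insert (hsub.union_right (B.biUnion s))
        (x := fun p => if own p ∈ B then 0 else x p)
        (y := fun p => if own p ∈ insert j B then 0 else x p) (Q := Pol j)
        (fun p => by split_ifs; exacts [le_rfl, hx0 p])
        (fun p => by split_ifs; exacts [zero_le_one, hx1 p])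
        (fun p hp => by rw [owner_eq hdisj hown hp, if_pos (Finset.mem_insert_self j B)])
        (fun p hp => by
          have : own p ≠ j := by rintro rfl; exact hp (hown p)
          simp [this])
        (fun p => by split_ifs; exacts [le_rfl, hx0 p])
        (by rw [Finset.sum_congr rfl hx, hsum])
      refine this.trans (le_of_eq ?_)
      rw [hμ]
      refine Finset.sum_congr rfl fun p hp => ?_
      rw [hx p hp, hU]
      congr 2
      ext R
      congr 1
      ext q
      simp only [Finset.mem_union, Finset.mem_insert, Finset.mem_singleton]
      tauto
  simpa [multilinear_zero_right] using key Finset.univ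

variable {G : SimpleGraph A} {T : ℕ} {F : A → Info P}

omit [Fintype A] [DecidableEq A] [Fintype P] in
theorem Invariant.sum_eq_one (h : Invariant G Pol T T F) (hT : 1 ≤ T) (i : A) :
    ∑ p ∈ Pol i, (F i).prob p = 1 := by
  rw [h.sum_own i, mul_one_div_cancel (by positivity)]

omit [Fintype A] [DecidableEq A] [Fintype P] in
theorem Invariant.sum_ofReal_eq_one (h : Invariant G Pol T T F) (hT : 1 ≤ T) (i : A) :
    ∑ p : {p // p ∈ Pol i}, ENNReal.ofReal ((F i).prob p) = 1 := by
  rw [Finset.sum_coe_sort (Pol i) fun p => ENNReal.ofReal ((F i).prob p),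
    ← ENNReal.ofReal_sum_of_nonneg fun p _ => Info.prob_nonneg (h.lawful i) p,
    h.sum_eq_one hT, ENNReal.ofReal_one]

omit [Fintype A] [DecidableEq A] [Fintype P] in
theorem Invariant.samplePolicy_eq (h : Invariant G Pol T T F) (hT : 1 ≤ T) (i : A) :
    samplePolicy Pol F i = (PMF.ofFintype (fun p : {p // p ∈ Pol i} =>
      ENNReal.ofReal ((F i).prob p)) (h.sum_ofReal_eq_one hT i)).map
        fun p : {p // p ∈ Pol i} => ({(p : P)} : Finset P) := by
  rw [samplePolicy, dif_pos (h.sum_ofReal_eq_one hT i)]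
  exact PMF.map_comp Subtype.val _ fun p : P => ({p} : Finset P)

omit [Fintype A] [DecidableEq A] in
theorem Invariant.mean_samplePolicy (h : Invariant G Pol T T F) (hT : 1 ≤ T) (i : A)
    (g : Finset P → ℝ) : mean (samplePolicy Pol F i) g = ∑ p ∈ Pol i, (F i).prob p * g {p} := by
  rw [h.samplePolicy_eq hT i, mean_map, mean,
    ← Finset.sum_coe_sort (Pol i) fun p => (F i).prob p * g {p}]
  refine Finset.sum_congr rfl fun p _ => ?_
  rw [PMF.ofFintype_apply, ENNReal.toReal_ofReal (Info.prob_nonneg (h.lawful i) _)]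
  rfl

omit [Fintype A] [DecidableEq A] [Fintype P] in
theorem Invariant.exists_of_mem_support_samplePolicy (h : Invariant G Pol T T F) (hT : 1 ≤ T)
    {i : A} {S : Finset P} (hS : S ∈ (samplePolicy Pol F i).support) : ∃ p ∈ Pol i, S = {p} := by
  rw [h.samplePolicy_eq hT i, PMF.mem_support_map_iff] at hS
  obtain ⟨p, -, hp⟩ := hS
  exact ⟨p, p.2, hp.symm⟩

theorem Invariant.admissible_output (hdisj : ∀ i j, i ≠ j → Disjoint (Pol i) (Pol j))
    (h : Invariant G Pol T T F) (hT : 1 ≤ T) {S : Finset P}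
    (hS : S ∈ (output Pol F).support) : Admissible Pol S := by
  rw [output, PMF.mem_support_map_iff] at hS
  obtain ⟨s, hs, rfl⟩ := hS
  have hs' : ∀ i, ∃ p ∈ Pol i, s i = {p} := fun i => by
    refine h.exists_of_mem_support_samplePolicy hT ?_
    rw [PMF.mem_support_iff] at hs ⊢
    exact Finset.prod_ne_zero_iff.1 (show ∏ i, samplePolicy Pol F i (s i) ≠ 0 from hs) i
      (Finset.mem_univ i)
  choose q hq hsq using hs'
  intro i
  refine (Finset.card_le_card (t := {q i}) fun p hp => ?_).trans (by simp)
  simp only [Finset.mem_inter, Finset.mem_biUnion, Finset.mem_univ, true_and, hsq,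
    Finset.mem_singleton] at hp ⊢
  obtain ⟨⟨j, rfl⟩, hpi⟩ := hp
  by_cases hij : j = i
  · rw [hij]
  · exact absurd hpi (Finset.disjoint_left.1 (hdisj j i hij) (hq j))

theorem Invariant.multilinear_le_expectedUtility
    (hdisj : ∀ i j, i ≠ j → Disjoint (Pol i) (Pol j)) {f : Finset P → ℝ} (hsub : IsSubmodular f)
    (h : Invariant G Pol T T F) (hT : 1 ≤ T) {own : P → A} (hown : ∀ p, p ∈ Pol (own p)) :
    multilinear f (ownProb own F) ≤ expectedUtility Pol f F := by
  have hT' : (T : ℝ) ≠ 0 := by positivity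
  have hown' : ∀ i, ∀ p ∈ Pol i, ownProb own F p = (F i).prob p := fun i p hp => by
    rw [ownProb, owner_eq hdisj hown hp]
  have := multilinear_le_mean_indep hdisj hsub (x := ownProb own F)
    (fun p => (h.ownProb_bounds hown (own p) p).1)
    (fun p => (h.ownProb_bounds hown (own p) p).2.2.trans (mul_one_div_cancel hT').le)
    (fun i => by rw [Finset.sum_congr rfl (hown' i), h.sum_eq_one hT]) hown
    (μ := samplePolicy Pol F) (fun i g => by
      rw [h.mean_samplePolicy hT]
      exact Finset.sum_congr rfl fun p hp => by rw [hown' i p hp])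
  refine this.trans (le_of_eq ?_)
  change _ = mean (output Pol F) f
  rw [output, mean_map]
  rfl

end Rounding

/-! ### The factor 1 - 1/e and the final assembly. -/

theorem one_sub_one_div_pow_le {T : ℕ} (hT : 1 ≤ T) :
    (1 - 1 / (T : ℝ)) ^ T ≤ 1 / Real.exp 1 := by
  have hT' : (T : ℝ) ≠ 0 := by positivity
  have h0 : 0 ≤ 1 - 1 / (T : ℝ) := by
    rw [sub_nonneg, div_le_one (by positivity)]
    exact_mod_cast hT
  calc (1 - 1 / (T : ℝ)) ^ T ≤ Real.exp (-(1 / (T : ℝ))) ^ T :=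
        pow_le_pow_left₀ h0 (Real.one_sub_le_exp_neg _) T
    _ = 1 / Real.exp 1 := by
        rw [← Real.exp_nat_mul, mul_neg, mul_one_div_cancel hT', Real.exp_neg, one_div]

end DistGreedy

theorem mainTheorem1 {A P L : Type*} [Fintype A] [DecidableEq A] [Fintype P] [DecidableEq P]
    [Fintype L] [DecidableEq L]
    (G : SimpleGraph A) (hG : G.Connected)
    (Pol : A → Finset P) (hne : ∀ i, (Pol i).Nonempty)
    (hdisj : ∀ i j, i ≠ j → Disjoint (Pol i) (Pol j)) (hcover : ∀ p, ∃ i, p ∈ Pol i)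
    (f : Finset P → ℝ) (hf0 : f ∅ = 0) (hmono : Monotone f) (hsub : DistGreedy.IsSubmodular f)
    (Sopt : Finset P) (hopt : DistGreedy.IsOptimizer Pol f Sopt)
    (T : ℕ) (hT : 1 ≤ T) (K : A → ℕ)
    (β : P → L)
    (hK : ∀ i l, 2 * (((Pol i).filter fun p => β p = l).card : ℝ)
      * Real.exp (-(K i : ℝ) / (8 * (T : ℝ) ^ 2)) ≤ 1)
    (sel : DistGreedy.Selection Pol) (hsel : sel.IsArgmax) :
    (∀ t ≤ T, ∀ F ∈ (DistGreedy.run G Pol f T K β sel t).support, ∀ i p,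
      0 ≤ (F i).prob p ∧ (F i).prob p ≤ 1) ∧
    (∀ F ∈ (DistGreedy.run G Pol f T K β sel T).support,
      (∀ i, ∑ p ∈ Pol i, (F i).prob p = 1) ∧
      ∀ S ∈ (DistGreedy.output Pol F).support, DistGreedy.Admissible Pol S) ∧
    ENNReal.ofReal
        ((∏ i, (1 - 2 * Real.exp (-(K i : ℝ) / (8 * (T : ℝ) ^ 2))) ^ (Pol i).card) ^ T) ≤
      (DistGreedy.run G Pol f T K β sel T).toOuterMeasure
        {F | (1 - 1 / Real.exp 1) *
            (1 - (2 * (Fintype.card A : ℝ) ^ 2 * (G.diam : ℝ) + (Fintype.card A : ℝ) ^ 2 / 2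
              + (Fintype.card A : ℝ)) * (1 / (T : ℝ))) * f Sopt
          ≤ DistGreedy.expectedUtility Pol f F} := by
  choose own hown using hcover
  have hT' : (T : ℝ) ≠ 0 := by positivity
  refine ⟨fun t ht F hF i p => ?_, fun F hF => ?_, ?_⟩
  · have hI := DistGreedy.Invariant.of_mem_support hdisj hF
    refine ⟨DistGreedy.Info.prob_nonneg (hI.lawful i) p,
      (hI.prob_le (fun p => ⟨own p, hown p⟩) i p).trans ?_⟩
    rw [mul_one_div, div_le_one (by positivity)]
    exact_mod_cast ht
  · have hI := DistGreedy.Invariant.of_mem_support hdisj hF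
    exact ⟨hI.sum_eq_one hT, fun S hS => hI.admissible_output hdisj hT hS⟩
  · have hprod : 0 ≤ ∏ i, (1 - 2 * Real.exp (-(K i : ℝ) / (8 * (T : ℝ) ^ 2))) ^ (Pol i).card :=
      Finset.prod_nonneg fun i _ => pow_nonneg (DistGreedy.one_sub_two_mul_exp_nonneg hK (hne i)) _
    rw [ENNReal.ofReal_pow hprod]
    refine (DistGreedy.le_run_toOuterMeasure hG hne hdisj hf0 hmono hsub hopt hK hsel hown T
      le_rfl).trans (PMF.toOuterMeasure_mono _ ?_)
    rintro F ⟨hF, hsupp⟩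
    have hI := DistGreedy.Invariant.of_mem_support hdisj hsupp
    have hround := hI.multilinear_le_expectedUtility hdisj hsub hT hown
    have hpow := DistGreedy.one_sub_one_div_pow_le hT
    have hM : 0 ≤ f Sopt := hf0 ▸ hmono (Finset.empty_subset Sopt)
    have he : 1 / Real.exp 1 ≤ 1 := by
      rw [div_le_one (Real.exp_pos 1)]
      exact Real.one_le_exp zero_le_one
    have hml : 0 ≤ DistGreedy.multilinear f (DistGreedy.ownProb own F) :=
      DistGreedy.multilinear_nonneg (fun p => (hI.ownProb_bounds hown (own p) p).1)
        (fun p => (hI.ownProb_bounds hown (own p) p).2.2.trans (mul_one_div_cancel hT').le)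
        fun R => hf0 ▸ hmono (Finset.empty_subset R)
    change _ ≤ DistGreedy.expectedUtility Pol f F
    change _ ≤ DistGreedy.multilinear f _ at hF
    refine le_trans ?_ hround
    set C := 1 - (2 * (Fintype.card A : ℝ) ^ 2 * (G.diam : ℝ) + (Fintype.card A : ℝ) ^ 2 / 2
      + (Fintype.card A : ℝ)) * (1 / (T : ℝ))
    rw [mul_assoc]
    -- Replacing 1 - (1 - 1/T)^T by 1 - 1/e needs C ≥ 0; for C ≤ 0 the left side is nonpositive and
    -- the claim trivial.
    rcases le_total 0 C with hC | hC
    · exact (mul_le_mul_of_nonneg_right (by linarith) (mul_nonneg hC hM)).trans hF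
    · exact (mul_nonpos_of_nonneg_of_nonpos (by linarith)
        (mul_nonpos_of_nonpos_of_nonneg hC hM)).trans hml
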